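/- Notation. Let $K\subset\mathbb{C}$ be an abelian number field (i.e. $K$ is contained in a cyclotomic field), $\zeta_n=e^{2\pi i/n}$, $v_p$ the $p$-adic valuation, $[x,y]=xyx^{-1}y^{-1}$. Let $p$ be a prime with $\zeta_p\in K$ and $r$ an odd prime with $r\equiv 1 \pmod p$. Let $m$ be the least even positive integer with $K\subseteq\mathbb{Q}(\zeta_m)$, $a$ the largest integer with $\zeta_{p^a}\in K$, $s=v_p(m)$, and let $b=s$ if $p$ is odd or $\zeta_4\in K$; otherwise $b=s+v_p([K\cap\mathbb{Q}(\zeta_{p^s}):\mathbb{Q}])+2$ if $\mathrm{Gal}(K(\zeta_{p^{2a+s}})/K)$ is not cyclic, and $b=s+1$ if it is cyclic. Put $\zeta=\zeta_{p^{a+b}}$, $F=\mathbb{Q}(\zeta_m,\zeta)$, $G=\mathrm{Gal}(F/K)$, $C=\mathrm{Gal}(F/K(\zeta))$, $D=\mathrm{Gal}(F/K(\zeta+\zeta^{-1}))$. Let $q$ be an odd prime not dividing $m$, $G_q=\mathrm{Gal}(F(\zeta_q)/K)$, and identify $G$ with the subgroup $\mathrm{Gal}(F(\zeta_q)/K(\zeta_q))$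 of $G_q$. Let $c_0$ be a generator of $\mathrm{Gal}(F(\zeta_q)/F)$. Fix $\rho,\sigma\in G$ and $B=\langle c_1\rangle\times\cdots\times\langle c_n\rangle\le C$ with $D=B\times\langle\rho\rangle$, $C=B\times\langle\rho^2\rangle$, $G/C=\langle\rho C\rangle\times\langle\sigma C\rangle$, where $\rho=1$ if $C=D$ and $\sigma=1$ if $D=G$, and an integer $c$ with $\sigma(\zeta)=\zeta^c$ and $v_p(c^{|\sigma C|}-1)=a+b$, where $v_p(c-1)=a$ if $G/C$ is cyclic and $G\neq D$, $v_p(c-1)=a+b$ if $G/C$ is cyclic and $G=D$, and $v_p(c-1)\ge 2$ if $G/C$ is not cyclic. Put $q_i=|c_i|$ for $0\le i\le n$. Let $e$ be the ramification index of $K(\zeta_r)/K$ at $r$, $f$ the residue degree of $K/\mathbb{Q}$ at $r$, and $\nu(r)=\max\{0,\,a+v_p(e)-v_p(r^f-1)\}$. Let $\phi\in G$ be a Frobenius automorphism at $r$, i.e. $\phi(x)=x^{r^f}$ for all roots of unity $x\in F$ of order prime to $r$, and write $\phi=\rho^{j'}\sigma^j\eta$ with $\eta\in B$, $0\le j'<|\rho|$,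 $0\le j<|\sigma C|$. Let $\theta$ be a generator of the inertia group of $G_q$ at a prime of $F(\zeta_q)$ above $r$, and write $\theta=c_0^{s_0}c_1^{s_1}\cdots c_n^{s_n}\rho^{2s_{n+1}}$ with $0\le s_i<q_i$ for $0\le i\le n$ and $0\le s_{n+1}\le|\rho^2|$. Let $A=(F(\zeta_q)/K,\alpha)=\bigoplus_{g\in G_q}F(\zeta_q)u_g$ be the crossed product algebra with $u_g x=g(x)u_g$ for $x\in F(\zeta_q)$ and $u_gu_h=\alpha_{g,h}u_{gh}$, where $\alpha$ is a normalized $2$-cocycle on $G_q$ with values in $\langle\zeta_4\rangle$ if $p^s=2$ and in $\langle\zeta_{p^s}\rangle$ otherwise. Put $$\xi_0=[u_\theta,\,u_\rho^{j'}u_\sigma^{j}]\,\gamma_\theta^{(r^f-1)/e}\quad\text{with }\gamma_\theta=u_\theta^{e},\qquad \beta_{i\rho}=[u_\rho,u_{c_i}],\quad \beta_{i\sigma}=[u_\sigma,u_{c_i}]\quad(0\le i\le n).$$ Statement. 1. If $G/C$ is cyclic, then $\xi_0^{p^{\nu(r)}}=1$. 2. If $G/C$ is not cyclic, let $\mu_i=\beta_{i\rho}^{(1-c)/2}\beta_{i\sigma}^{-1}$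 for $0\le i\le n$. Then each $\mu_i=\pm1$, and $$\xi_0^{p^{\nu(r)}}=\prod_{i=0}^n\mu_i^{2^{\nu(r)}(j+j')s_i}.$$ -/

import Mathlib

open scoped NumberField commutatorElement

namespace CyclotomicAlgebra

/-! ### Crossed products -/

/-- A normalized factor set (2-cocycle) of `Gal(E/k)` with values in `Eˣ`:
`f (g h, j) * f (g, h) = g (f (h, j)) * f (g, h j)` and `f (1, g) = f (g, 1) = 1`. -/
structure FactorSet (k E : Type*) [Field k] [Field E] [Algebra k E] where
  toFun : Gal(E/k) × Gal(E/k) → Eˣ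
  isMulCocycle : groupCohomology.IsMulCocycle₂ toFun
  map_one_left : ∀ g, toFun (1, g) = 1
  map_one_right : ∀ g, toFun (g, 1) = 1

section

variable {k E : Type*} [Field k] [Field E] [Algebra k E] (α : FactorSet k E)

theorem FactorSet.cocycle (g h j : Gal(E/k)) :
    (α.toFun (g * h, j) : E) * α.toFun (g, h) = g (α.toFun (h, j)) * α.toFun (g, h * j) :=
  congrArg Units.val (α.isMulCocycle g h j)

/-- The multiplication of formal sums `∑ a_g u_g` determined by
`(a u_g)(b u_h) = a g(b) α(g, h) u_{gh}`. -/
noncomputable def mulFun (x y : Gal(E/k) →₀ E) : Gal(E/k) →₀ E :=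
  x.sum fun g a => y.sum fun h b => Finsupp.single (g * h) (a * g b * α.toFun (g, h))

theorem mulFun_single_single (g h : Gal(E/k)) (a b : E) :
    mulFun α (.single g a) (.single h b) = .single (g * h) (a * g b * α.toFun (g, h)) := by
  rw [mulFun, Finsupp.sum_single_index, Finsupp.sum_single_index]
  · simp
  · simp

theorem add_mulFun (x y z : Gal(E/k) →₀ E) :
    mulFun α (x + y) z = mulFun α x z + mulFun α y z := by
  unfold mulFun
  refine Finsupp.sum_add_index' ?_ ?_
  · intro g
    simp
  · intro g a b
    rw [← Finsupp.sum_add]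
    refine Finsupp.sum_congr fun h _ => ?_
    rw [← Finsupp.single_add, add_mul, add_mul]

theorem mulFun_add (x y z : Gal(E/k) →₀ E) :
    mulFun α x (y + z) = mulFun α x y + mulFun α x z := by
  unfold mulFun
  rw [← Finsupp.sum_add]
  refine Finsupp.sum_congr fun g _ => ?_
  refine Finsupp.sum_add_index' ?_ ?_
  · intro h
    simp
  · intro h a b
    rw [← Finsupp.single_add, map_add, mul_add, add_mul]

theorem zero_mulFun (x : Gal(E/k) →₀ E) : mulFun α 0 x = 0 := Finsupp.sum_zero_index

theorem mulFun_zero (x : Gal(E/k) →₀ E) : mulFun α x 0 = 0 := by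
  simp [mulFun]

theorem mulFun_assoc (x y z : Gal(E/k) →₀ E) :
    mulFun α (mulFun α x y) z = mulFun α x (mulFun α y z) := by
  induction x using Finsupp.induction_linear with
  | zero => simp only [zero_mulFun]
  | add x x' hx hx' => simp only [add_mulFun, hx, hx']
  | single g a =>
    induction y using Finsupp.induction_linear with
    | zero => simp only [zero_mulFun, mulFun_zero]
    | add y y' hy hy' => simp only [add_mulFun, mulFun_add, hy, hy']
    | single h b =>
      induction z using Finsupp.induction_linear with
      | zero => simp only [mulFun_zero]
      | add z z' hz hz' => simp only [mulFun_add, hz, hz']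
      | single j c =>
        have key := α.cocycle g h j
        simp only [mulFun_single_single, mul_assoc, map_mul, AlgEquiv.mul_apply]
        congr 1
        linear_combination (a * g b * g (h c)) * key

theorem one_mulFun (x : Gal(E/k) →₀ E) : mulFun α (.single 1 1) x = x := by
  induction x using Finsupp.induction_linear with
  | zero => exact mulFun_zero α _
  | add x y hx hy => rw [mulFun_add, hx, hy]
  | single g a => simp [mulFun_single_single, α.map_one_left]

theorem mulFun_one (x : Gal(E/k) →₀ E) : mulFun α x (.single 1 1) = x := by
  induction x using Finsupp.induction_linear with
  | zero => exact zero_mulFun α _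
  | add x y hx hy => rw [add_mulFun, hx, hy]
  | single g a => simp [mulFun_single_single, α.map_one_right]

theorem smul_mulFun (a : k) (x y : Gal(E/k) →₀ E) :
    mulFun α (a • x) y = a • mulFun α x y := by
  induction x using Finsupp.induction_linear with
  | zero => simp only [smul_zero, zero_mulFun]
  | add x x' hx hx' => simp only [smul_add, add_mulFun, hx, hx']
  | single g b =>
    induction y using Finsupp.induction_linear with
    | zero => simp only [smul_zero, mulFun_zero]
    | add y y' hy hy' => simp only [smul_add, mulFun_add, hy, hy']
    | single h c =>
      simp only [Finsupp.smul_single, mulFun_single_single, smul_mul_assoc]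

theorem mulFun_smul (a : k) (x y : Gal(E/k) →₀ E) :
    mulFun α x (a • y) = a • mulFun α x y := by
  induction x using Finsupp.induction_linear with
  | zero => simp only [smul_zero, zero_mulFun]
  | add x x' hx hx' => simp only [smul_add, add_mulFun, hx, hx']
  | single g b =>
    induction y using Finsupp.induction_linear with
    | zero => simp only [smul_zero, mulFun_zero]
    | add y y' hy hy' => simp only [smul_add, mulFun_add, hy, hy']
    | single h c =>
      simp only [Finsupp.smul_single, mulFun_single_single, smul_mul_assoc, mul_smul_comm, map_smul]

/-- The crossed product algebra `(E/k, α) = ⨁_{g ∈ Gal(E/k)} E u_g`, with `u_g x = g(x) u_g` for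
`x ∈ E` and `u_g u_h = α(g, h) u_{gh}`. -/
def CrossedProduct (_α : FactorSet k E) : Type _ := Gal(E/k) →₀ E

namespace CrossedProduct

noncomputable instance : AddCommGroup (CrossedProduct α) :=
  inferInstanceAs (AddCommGroup (Gal(E/k) →₀ E))

noncomputable instance : Module k (CrossedProduct α) :=
  inferInstanceAs (Module k (Gal(E/k) →₀ E))

noncomputable instance : Ring (CrossedProduct α) :=
  { (inferInstance : AddCommGroup (CrossedProduct α)) with
    mul := mulFun α
    one := (Finsupp.single 1 1 : Gal(E/k) →₀ E)
    left_distrib := mulFun_add α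
    right_distrib := add_mulFun α
    zero_mul := zero_mulFun α
    mul_zero := mulFun_zero α
    mul_assoc := mulFun_assoc α
    one_mul := one_mulFun α
    mul_one := mulFun_one α }

noncomputable instance : Algebra k (CrossedProduct α) :=
  Algebra.ofModule (smul_mulFun α) (mulFun_smul α)

/-- The element `a u_g`. -/
noncomputable def single (g : Gal(E/k)) (a : E) : CrossedProduct α :=
  (Finsupp.single g a : Gal(E/k) →₀ E)

theorem one_def : (1 : CrossedProduct α) = single α 1 1 := rfl

theorem single_mul_single (g h : Gal(E/k)) (a b : E) :
    single α g a * single α h b = single α (g * h) (a * g b * α.toFun (g, h)) :=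
  mulFun_single_single α g h a b

/-- The basis element `u_g`, as a unit of the crossed product. -/
noncomputable def u (g : Gal(E/k)) : (CrossedProduct α)ˣ where
  val := single α g 1
  inv := single α g⁻¹ (α.toFun (g⁻¹, g) : E)⁻¹
  val_inv := by
    have h := α.cocycle g g⁻¹ g
    simp only [mul_inv_cancel, inv_mul_cancel, α.map_one_left, α.map_one_right, one_mul, mul_one,
      Units.val_one] at h
    rw [single_mul_single, mul_inv_cancel, one_mul, h, ← map_mul,
      inv_mul_cancel₀ (Units.ne_zero _), map_one, one_def]
  inv_val := by
    rw [single_mul_single, inv_mul_cancel, map_one, mul_one,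
      inv_mul_cancel₀ (Units.ne_zero _), one_def]

end CrossedProduct

end

/-! ### The fields -/

/-- The root of unity `ζ_n = exp (2πi/n)`. -/
noncomputable def zeta (n : ℕ) : ℂ := Complex.exp (2 * Real.pi * Complex.I / n)

/-- The cyclotomic field `ℚ(ζ_n)`. -/
noncomputable def cyclotomic (n : ℕ) : IntermediateField ℚ ℂ :=
  IntermediateField.adjoin ℚ {zeta n}

/-- `K` is an abelian number field: it is contained in some cyclotomic field. -/
def IsAbelianNumberField (K : IntermediateField ℚ ℂ) : Prop :=
  ∃ n : ℕ, 0 < n ∧ K ≤ cyclotomic n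

/-- The field obtained from `K` by adjoining the roots of unity `ζ_n`, `n ∈ S`. -/
noncomputable def adjoinZeta (K : IntermediateField ℚ ℂ) (S : Set ℕ) : IntermediateField K ℂ :=
  IntermediateField.adjoin K (zeta '' S)

/-- The least even positive integer `m` with `K ⊆ ℚ(ζ_m)`. -/
noncomputable def mK (K : IntermediateField ℚ ℂ) : ℕ :=
  sInf {m | 0 < m ∧ Even m ∧ K ≤ cyclotomic m}

/-- The largest integer `a` with `ζ_{p^a} ∈ K`. -/
noncomputable def aK (K : IntermediateField ℚ ℂ) (p : ℕ) : ℕ :=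
  sSup {a | zeta (p ^ a) ∈ K}

/-- `s = v_p(m)`. -/
noncomputable def sK (K : IntermediateField ℚ ℂ) (p : ℕ) : ℕ := padicValNat p (mK K)

open Classical in
/-- The integer `b`. -/
noncomputable def bK (K : IntermediateField ℚ ℂ) (p : ℕ) : ℕ :=
  if Odd p ∨ zeta 4 ∈ K then sK K p
  else if ¬ IsCyclic Gal(adjoinZeta K {p ^ (2 * aK K p + sK K p)}/K) then
    sK K p + padicValNat p (Module.finrank ℚ ↥(K ⊓ cyclotomic (p ^ sK K p))) + 2
  else sK K p + 1

/-- `F = ℚ(ζ_m, ζ_{p^{a+b}})`; since `K ⊆ ℚ(ζ_m)`, this is obtained from `K` by adjoining the two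
roots of unity. -/
noncomputable abbrev F (K : IntermediateField ℚ ℂ) (p : ℕ) : IntermediateField K ℂ :=
  adjoinZeta K {mK K, p ^ (aK K p + bK K p)}

/-- `F(ζ_q)`. -/
noncomputable abbrev Fq (K : IntermediateField ℚ ℂ) (p q : ℕ) : IntermediateField K ℂ :=
  adjoinZeta K {mK K, p ^ (aK K p + bK K p), q}

/-- `ζ = ζ_{p^{a+b}}` as an element of `F(ζ_q)`. -/
noncomputable def zetaW (K : IntermediateField ℚ ℂ) (p q : ℕ) : Fq K p q :=
  ⟨zeta (p ^ (aK K p + bK K p)), IntermediateField.subset_adjoin _ _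
    (Set.mem_image_of_mem _ (Set.mem_insert_of_mem _ (Set.mem_insert _ _)))⟩

/-- `ζ_q` as an element of `F(ζ_q)`. -/
noncomputable def zetaQ (K : IntermediateField ℚ ℂ) (p q : ℕ) : Fq K p q :=
  ⟨zeta q, IntermediateField.subset_adjoin _ _
    (Set.mem_image_of_mem _ (Set.mem_insert_of_mem _ (Set.mem_insert_of_mem _ rfl)))⟩

/-! ### The Galois groups -/

/-- `Gal(E/K(S))` as a subgroup of `Gal(E/K)`, for `S ⊆ E`. -/
noncomputable def galOver {K : IntermediateField ℚ ℂ} (E : IntermediateField K ℂ) (S : Set E) :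
    Subgroup Gal(E/K) :=
  (IntermediateField.adjoin K S).fixingSubgroup

/-- `G_q = Gal(F(ζ_q)/K)`. -/
noncomputable abbrev Gq (K : IntermediateField ℚ ℂ) (p q : ℕ) : Type := Gal(Fq K p q/K)

/-- `G = Gal(F/K)`, identified with the subgroup `Gal(F(ζ_q)/K(ζ_q))` of `G_q`. -/
noncomputable def G (K : IntermediateField ℚ ℂ) (p q : ℕ) : Subgroup (Gq K p q) :=
  galOver (Fq K p q) {zetaQ K p q}

/-- `C = Gal(F/K(ζ))`, identified with the subgroup `Gal(F(ζ_q)/K(ζ_q, ζ))` of `G_q`. -/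
noncomputable def C (K : IntermediateField ℚ ℂ) (p q : ℕ) : Subgroup (Gq K p q) :=
  galOver (Fq K p q) {zetaQ K p q, zetaW K p q}

/-- `D = Gal(F/K(ζ + ζ⁻¹))`, identified with the subgroup `Gal(F(ζ_q)/K(ζ_q, ζ + ζ⁻¹))`
of `G_q`. -/
noncomputable def D (K : IntermediateField ℚ ℂ) (p q : ℕ) : Subgroup (Gq K p q) :=
  galOver (Fq K p q) {zetaQ K p q, zetaW K p q + (zetaW K p q)⁻¹}

theorem isMulCommutative_gal (K : IntermediateField ℚ ℂ) (S : Set ℕ) :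
    IsMulCommutative Gal(adjoinZeta K S/K) := by
  refine ⟨⟨fun f g => ?_⟩⟩
  have key : ∀ x : adjoinZeta K S, f (g x) = g (f x) := by
    rintro ⟨x, hx⟩
    induction hx using IntermediateField.adjoin_induction with
    | mem x hx =>
      obtain ⟨n, hn, rfl⟩ := hx
      rcases eq_or_ne n 0 with rfl | h0
      · have : (⟨zeta 0, IntermediateField.subset_adjoin _ _ ⟨0, hn, rfl⟩⟩ : adjoinZeta K S) = 1 :=
          Subtype.ext (by simp [zeta])
        simp [this]
      · have hr : IsPrimitiveRoot
            (⟨zeta n, IntermediateField.subset_adjoin _ _ ⟨n, hn, rfl⟩⟩ : adjoinZeta K S) n :=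
          IsPrimitiveRoot.of_map_of_injective (f := (adjoinZeta K S).val)
            (Complex.isPrimitiveRoot_exp n h0) Subtype.val_injective
        have := NeZero.mk h0
        obtain ⟨i, -, hi⟩ := hr.eq_pow_of_pow_eq_one
          (show f _ ^ n = 1 by rw [← map_pow, hr.pow_eq_one, map_one])
        obtain ⟨j, -, hj⟩ := hr.eq_pow_of_pow_eq_one
          (show g _ ^ n = 1 by rw [← map_pow, hr.pow_eq_one, map_one])
        rw [← hi, ← hj, map_pow, map_pow, ← hi, ← hj, ← pow_mul, ← pow_mul, mul_comm]
    | algebraMap x =>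
      have : (⟨algebraMap K ℂ x, IntermediateField.algebraMap_mem _ x⟩ : adjoinZeta K S)
        = algebraMap K _ x := rfl
      rw [this, AlgEquiv.commutes, AlgEquiv.commutes, AlgEquiv.commutes]
    | add x y hx hy ihx ihy =>
      have := congrArg₂ (· + ·) ihx ihy
      simp only [← map_add] at this
      exact this
    | inv x hx ih =>
      have := congrArg (·⁻¹) ih
      simp only [← map_inv₀] at this
      exact this
    | mul x y hx hy ihx ihy =>
      have := congrArg₂ (· * ·) ihx ihy
      simp only [← map_mul] at this
      exact this
  exact AlgEquiv.ext key

instance normal_subgroup (K : IntermediateField ℚ ℂ) (p q : ℕ) (H : Subgroup (Gq K p q)) :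
    H.Normal := by
  refine ⟨fun h hh g => ?_⟩
  have := (isMulCommutative_gal K {mK K, p ^ (aK K p + bK K p), q}).is_comm.comm g h
  rwa [this, mul_inv_cancel_right]

/-- The quotient group `G/C`. -/
noncomputable abbrev GmodC (K : IntermediateField ℚ ℂ) (p q : ℕ) : Type := G K p q ⧸ (C K p q).subgroupOf (G K p q)

/-- `|σ C|`, the order of `σ` modulo `C`. -/
noncomputable def orderModC {K : IntermediateField ℚ ℂ} {p q : ℕ} (σ : Gq K p q) : ℕ :=
  orderOf (σ : Gq K p q ⧸ C K p q)

/-- `B = ⟨c_1, …, c_n⟩`, for a family `c_0, c_1, …, c_n`. -/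
noncomputable def B {K : IntermediateField ℚ ℂ} {p q n : ℕ} (c : Fin (n + 1) → Gq K p q) :
    Subgroup (Gq K p q) :=
  ⨆ i : Fin n, Subgroup.zpowers (c i.succ)

/-- The choices of generators: `c_0` generates `Gal(F(ζ_q)/F)`, and `c_1, …, c_n`, `ρ`, `σ` and the
integer `t` with `σ(ζ) = ζ^t` are adapted to the action of `G` on `⟨ζ⟩`. -/
structure IsAdapted {K : IntermediateField ℚ ℂ} {p q n : ℕ} (c : Fin (n + 1) → Gq K p q)
    (ρ σ : Gq K p q) (t : ℤ) : Prop where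
  c_zero : Subgroup.zpowers (c 0) = galOver (Fq K p q) {x | (x : ℂ) ∈ F K p}
  /-- `B = ⟨c_1⟩ × ⋯ × ⟨c_n⟩` -/
  indep : iSupIndep fun i : Fin n => Subgroup.zpowers (c i.succ)
  /-- `D = B × ⟨ρ⟩` -/
  disjoint_rho : Disjoint (B c) (Subgroup.zpowers ρ)
  D_eq : B c ⊔ Subgroup.zpowers ρ = D K p q
  /-- `C = B × ⟨ρ²⟩` -/
  C_eq : B c ⊔ Subgroup.zpowers (ρ ^ 2) = C K p q
  rho_eq_one : C K p q = D K p q → ρ = 1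
  /-- `G/C = ⟨ρC⟩ × ⟨σC⟩` -/
  G_eq : Subgroup.zpowers ρ ⊔ Subgroup.zpowers σ ⊔ C K p q = G K p q
  rho_inf_sigma :
    (Subgroup.zpowers ρ ⊔ C K p q) ⊓ (Subgroup.zpowers σ ⊔ C K p q) = C K p q
  sigma_eq_one : D K p q = G K p q → σ = 1
  sigma_zeta : σ (zetaW K p q) = zetaW K p q ^ t
  val_pow : padicValInt p (t ^ orderModC σ - 1) = aK K p + bK K p
  val_cyclic : IsCyclic (GmodC K p q) → G K p q ≠ D K p q → padicValInt p (t - 1) = aK K p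
  val_cyclic' : IsCyclic (GmodC K p q) → G K p q = D K p q →
    padicValInt p (t - 1) = aK K p + bK K p
  val_noncyclic : ¬ IsCyclic (GmodC K p q) → 2 ≤ padicValInt p (t - 1)

/-! ### The prime `r` -/

/-- `e = e(K(ζ_r)/K, r)`, the ramification index of the prime `P` of `K` (lying over `r`). -/
noncomputable def eK (K : IntermediateField ℚ ℂ) (r : ℕ) (P : Ideal (𝓞 K)) : ℕ :=
  Ideal.ramificationIdxIn P (𝓞 (adjoinZeta K {r}))

/-- `f = f(K/ℚ, r)`. -/
noncomputable def fK (K : IntermediateField ℚ ℂ) (r : ℕ) : ℕ :=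
  Ideal.inertiaDegIn (Ideal.span {(r : ℤ)}) (𝓞 K)

/-- `ν(r) = max {0, a + v_p(e) - v_p(r^f - 1)}` (the subtraction of natural numbers is
truncated). -/
noncomputable def nu (K : IntermediateField ℚ ℂ) (p r : ℕ) (P : Ideal (𝓞 K)) : ℕ :=
  aK K p + padicValNat p (eK K r P) - padicValNat p (r ^ fK K r - 1)

/-- `φ ∈ G = Gal(F/K)` is a Frobenius automorphism at `r`: it raises the roots of unity of `F` of
order prime to `r` to the power `r^f`. -/
def IsFrobenius {K : IntermediateField ℚ ℂ} {p q : ℕ} (r : ℕ) (φ : Gq K p q) : Prop :=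
  φ ∈ G K p q ∧ ∀ (k : ℕ) (x : Fq K p q), k.Coprime r → (x : ℂ) ∈ F K p → x ^ k = 1 →
    φ x = x ^ r ^ fK K r

/-! ### The invariants of a cyclotomic algebra -/

section

variable {K : IntermediateField ℚ ℂ} {p q : ℕ} (α : FactorSet K (Fq K p q))

/-- The restricted form of the cyclotomic algebra `(F(ζ_q)/K, α)`: the values of `α` lie in `⟨ζ_4⟩`
if `p^s = 2` and in `⟨ζ_{p^s}⟩` otherwise. -/
def IsRestricted : Prop :=
  ∀ x, α.toFun x ∈ rootsOfUnity (if p ^ sK K p = 2 then 4 else p ^ sK K p) (Fq K p q)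

/-- `ξ₀ = [u_θ, u_ρ^{j'} u_σ^j] γ_θ^{(r^f - 1)/e}` with `γ_θ = u_θ^e`, in the unit group of
`(F(ζ_q)/K, α)`. -/
noncomputable def xi0 (ρ σ θ : Gq K p q) (j j' r : ℕ) (P : Ideal (𝓞 K)) : (CrossedProduct α)ˣ :=
  ⁅CrossedProduct.u α θ, CrossedProduct.u α ρ ^ j' * CrossedProduct.u α σ ^ j⁆ *
    (CrossedProduct.u α θ ^ eK K r P) ^ ((r ^ fK K r - 1) / eK K r P)

/-- `β_{xy} = [u_y, u_x]`, so that `u_y u_x = β_{xy} u_x u_y`. -/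
noncomputable def beta (x y : Gq K p q) : (CrossedProduct α)ˣ :=
  ⁅CrossedProduct.u α y, CrossedProduct.u α x⁆

/-- `μ = β_{cρ}^{(1-t)/2} β_{cσ}⁻¹`. -/
noncomputable def mu (ρ σ c : Gq K p q) (t : ℤ) : (CrossedProduct α)ˣ :=
  beta α c ρ ^ ((1 - t) / 2) * (beta α c σ)⁻¹

end

end CyclotomicAlgebra

open CyclotomicAlgebra

/-!
Write `W = ⟨ω⟩` for the group of roots of unity, of order `p ^ M` with `M ≤ b`, that contains the
values of the cocycle. It is normalized by all `u_g`, and modulo `W` the elements `u_g` multiply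
like the automorphisms `g`, which commute. Hence every commutator `[u_g, u_h]` is a power of `ω`,
and the theorem is a computation with exponents modulo `p ^ M`.

*Inertia.* The automorphism `θ` fixes the roots of unity of order prime to `r`
(`apply_eq_self_of_mem_inertia`), in particular `ζ`, and `θ ^ e = 1` (`pow_eK_eq_one`). Indeed `θ`
restricts to an element of the inertia group of `K(ζ_r)/K`, whose order is `e`, so `θ ^ e` fixes
`ζ_r` if `ζ_r` lies in `F(ζ_q)`; if `r` divides `m` and `θ ^ e` moved `ζ_m`, the restriction of
one of its powers would generate `Gal(ℚ(ζ_m)/ℚ(ζ_{m/r}))`, and `K` would lie in `ℚ(ζ_{m/r})`,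
against the minimality of `m` (`zeta_mem_fixedLift`). Therefore `u_θ ^ e = ω ^ γ` for some `γ`.

*One generator.* Let `τ` raise `ζ` to the power `t`, and let `u_τ u_θ u_τ⁻¹ = ω ^ β u_θ`.
Conjugating `u_θ ^ e = ω ^ γ` by `u_τ` gives `e β = (t - 1) γ`, and the exponent of
`[u_θ, u_τ ^ j] γ_θ ^ ((r ^ f - 1) / e)` is `γ (r ^ f - 1) / e - β (t ^ j - 1) / (t - 1)`. If
`r ^ f` is congruent to `t ^ j` modulo `p ^ (a + b)` and `v_p (t - 1) = a`, then it equals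
`(r ^ f - 1) / (e (t - 1))` times `(t - 1) γ - e β`, and multiplication by `p ^ ν(r)` makes the
first factor integral (`pow_dvd_exponent_of_cyclic`). When `G/C` is cyclic, `ρ` or `σ` is trivial
(`IsAdapted.eq_one_or_eq_one_of_isCyclic`), and this computation applies to the other one. When
`ρ ≠ 1`, it inverts `ζ`, which forces `p = 2` and `a = 1`, as it fixes `ζ_{p ^ a}`; both cannot be
trivial, because `ζ ∉ K(ζ_q)` (`C_ne_G`).

*Two generators.* When `G/C` is not cyclic, `ρ` inverts `ζ`, and `p = 2`, `a = 1`. Let `β` and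
`β'` be the exponents for `ρ` and `σ`. The commutation of `u_ρ` and `u_σ` modulo `W` gives
`2 β' = (1 - t) β`, so `μ = β (1 - t) / 2 - β'` is killed by `2`; it is also killed by `e`. The
computation above now leaves the error term `2 ^ ν(r) j μ`, and `2 ^ ν(r) j' μ` vanishes because,
for `j'` odd, `r ^ f ≡ -1` modulo `4` and so `ν(r) = v_2(e)` (`pow_dvd_exponent_of_not_cyclic`).
Finally `μ` is multiplicative, unchanged by factors in `W`, and trivial on `u_ρ ^ 2`
(`ConjBy.mul`, `ConjBy.zpow_self`, `ConjBy.sq`), which expresses the invariant of `θ` by those of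
the `c_i`.
-/

namespace CyclotomicAlgebra

/-! ### Divisibility of exponents -/

section

theorem pow_dvd_of_pow_padicValInt_add_dvd_mul {p : ℕ} (hp : p.Prime) {x y : ℤ} {M : ℕ}
    (hx : x ≠ 0) (h : (p : ℤ) ^ (padicValInt p x + M) ∣ x * y) : (p : ℤ) ^ M ∣ y := by
  have := Fact.mk hp
  rcases eq_or_ne y 0 with rfl | hy
  · exact dvd_zero _
  rw [padicValInt_dvd_iff] at h ⊢
  rw [padicValInt.mul hx hy] at h
  rcases h with h | h
  · exact absurd h (mul_ne_zero hx hy)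
  · exact Or.inr (by omega)

/-- The exponent computation for one generator, which raises `ζ` to the power `t`. Here `τ` stands
for `t ^ j`, `S` for `1 + t + ⋯ + t ^ (j - 1)` and `Q` for `r ^ f - 1`. The proof multiplies the
exponent by `e (t - 1)`, whose valuation is `a + v_p (e)`. -/
theorem pow_dvd_exponent_of_cyclic {p : ℕ} (hp : p.Prime) {M a b e ν : ℕ} {β γ t S τ Q k : ℤ}
    (he : e ≠ 0) (ht : t - 1 ≠ 0) (hta : padicValInt p (t - 1) = a) (hM : M ≤ b)
    (hQ : Q = e * k) (hS : S * (t - 1) = τ - 1)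
    (hcong : (p : ℤ) ^ (a + b) ∣ Q - (τ - 1))
    (hrel : (p : ℤ) ^ M ∣ e * β - (t - 1) * γ)
    (hν : (p : ℤ) ^ (a + padicValNat p e) ∣ p ^ ν * Q) :
    (p : ℤ) ^ M ∣ p ^ ν * (γ * k - S * β) := by
  have := Fact.mk hp
  have he' : (e : ℤ) ≠ 0 := by exact_mod_cast he
  refine pow_dvd_of_pow_padicValInt_add_dvd_mul hp (x := e * (t - 1)) (mul_ne_zero he' ht) ?_
  rw [padicValInt.mul he' ht, padicValInt.of_nat, hta]
  obtain ⟨h, hh⟩ := hcong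
  have key : (e : ℤ) * (t - 1) * (p ^ ν * (γ * k - S * β)) =
      -((p ^ ν * Q) * (e * β - (t - 1) * γ)) + p ^ (a + b) * e * (p ^ ν * h * β) := by
    rw [show (p : ℤ) ^ (a + b) * e * (p ^ ν * h * β) = e * p ^ ν * β * (p ^ (a + b) * h) by ring,
      ← hh]
    linear_combination (-(e : ℤ) * p ^ ν * β) * hS - p ^ ν * (t - 1) * γ * hQ
  rw [key]
  refine dvd_add (dvd_neg.2 ?_) (dvd_mul_of_dvd_left ?_ _)
  · rw [pow_add, add_comm (padicValNat p e)]
    exact mul_dvd_mul hν hrel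
  · have h1 : (p : ℤ) ^ padicValNat p e ∣ e := by exact_mod_cast pow_padicValNat_dvd
    have := mul_dvd_mul (pow_dvd_pow (p : ℤ) (show a + M ≤ a + b by omega)) h1
    rwa [← pow_add, show a + M + padicValNat p e = padicValNat p e + a + M by omega] at this

/-- The exponent computation for two generators, which raise `ζ` to the powers `-1` and `t`. Here
`S` and `T` stand for the geometric sums of length `j` and `j'` with ratios `t` and `-1`, and `Q`
for `r ^ f - 1`. -/
theorem pow_dvd_exponent_of_not_cyclic {M b e ν j j' : ℕ} {β β' γ t d S T Q k : ℤ}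
    (he : e ≠ 0) (ht : 1 - t = 2 * d) (ht4 : 4 ∣ t - 1) (hM : M ≤ b) (hb : 1 ≤ b)
    (hQ : Q = e * k) (hS : S * (t - 1) = t ^ j - 1) (hSj : 2 ∣ S - j)
    (hT : T * (-1 - 1) = (-1) ^ j' - 1)
    (hcong : (2 : ℤ) ^ (1 + b) ∣ Q - ((-1) ^ j' * t ^ j - 1))
    (hβ : (2 : ℤ) ^ M ∣ e * β - (-1 - 1) * γ)
    (hβ' : (2 : ℤ) ^ M ∣ e * β' - (t - 1) * γ)
    (hββ' : (2 : ℤ) ^ M ∣ 2 * β' - (1 - t) * β)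
    (hν : ν = 1 + padicValNat 2 e - padicValInt 2 Q) :
    (2 : ℤ) ^ M ∣ 2 ^ ν * (γ * k - ((-1) ^ j' * (S * β') + T * β))
      - (2 ^ ν * (j + j') : ℕ) * (d * β - β') := by
  have := Fact.mk Nat.prime_two
  set m := d * β - β' with hm
  set ε : ℤ := (-1) ^ j' with hε
  have h2m : (2 : ℤ) ^ M ∣ 2 * m := by
    have : 2 * m = -(2 * β' - (1 - t) * β) := by rw [hm]; linear_combination -β * ht
    rw [this]; exact dvd_neg.2 hββ'
  have hem : (2 : ℤ) ^ M ∣ e * m := by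
    have : e * m = d * (e * β - (-1 - 1) * γ) - (e * β' - (t - 1) * γ) := by
      rw [hm]; linear_combination γ * ht
    rw [this]; exact dvd_sub (dvd_mul_of_dvd_right hβ _) hβ'
  have heven : ∀ z : ℤ, 2 ∣ z → (2 : ℤ) ^ M ∣ z * m := by
    rintro z ⟨y, rfl⟩
    rw [mul_right_comm]
    exact dvd_mul_of_dvd_left h2m _
  have hε2 : 2 ∣ ε - 1 := ⟨-T, by linear_combination -hT⟩
  have hQν : (2 : ℤ) ^ (1 + padicValNat 2 e) ∣ 2 ^ ν * Q := by
    rcases eq_or_ne Q 0 with h0 | h0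
    · simp [h0]
    · have h1 : (2 : ℤ) ^ padicValInt 2 Q ∣ Q := by
        exact_mod_cast (padicValInt_dvd_iff (p := 2) _ Q).2 (Or.inr le_rfl)
      have h2 := mul_dvd_mul_left ((2 : ℤ) ^ ν) h1
      rw [← pow_add] at h2
      exact (pow_dvd_pow _ (by omega)).trans h2
  -- The part of the exponent that is proportional to `j`.
  have h1 : (2 : ℤ) ^ M ∣ 2 ^ ν * (γ * k - (ε * (S * β') + T * β) - j * m) := by
    have he' : (e : ℤ) ≠ 0 := by exact_mod_cast he
    refine pow_dvd_of_pow_padicValInt_add_dvd_mul Nat.prime_two (x := 2 * e)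
      (mul_ne_zero two_ne_zero he') ?_
    rw [padicValInt.mul two_ne_zero he', padicValInt.of_nat,
      show padicValInt 2 2 = 1 from padicValInt.self one_lt_two]
    obtain ⟨h, hh⟩ := hcong
    obtain ⟨g, hg⟩ : (2 : ℤ) ^ M ∣ (ε * S - j) * m := by
      refine heven _ ?_
      have : ε * S - j = (ε - 1) * S + (S - j) := by ring
      rw [this]; exact dvd_add (dvd_mul_of_dvd_left hε2 _) hSj
    have key : 2 * (e : ℤ) * (2 ^ ν * (γ * k - (ε * (S * β') + T * β) - j * m)) =
        (2 ^ ν * Q) * (e * β - (-1 - 1) * γ) - 2 ^ (1 + b) * e * (2 ^ ν * h * β)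
          + 2 * (2 ^ M * e) * (2 ^ ν * g) := by
      have e1 : (2 : ℤ) ^ (1 + b) * e * (2 ^ ν * h * β) =
        e * 2 ^ ν * β * (2 ^ (1 + b) * h) := by ring
      have e2 : 2 * ((2 : ℤ) ^ M * e) * (2 ^ ν * g) = 2 * e * 2 ^ ν * (2 ^ M * g) := by ring
      rw [e1, e2, ← hh, ← hg, hm]
      linear_combination (-(2 : ℤ) ^ ν * 2 * γ) * hQ + (2 ^ ν * e * β * ε) * hS
        + 2 ^ ν * e * β * hT + (2 ^ ν * e * ε * S * β) * ht
    rw [key]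
    have h3 : (2 : ℤ) ^ padicValNat 2 e ∣ e := by exact_mod_cast pow_padicValNat_dvd
    refine dvd_add (dvd_sub ?_ (dvd_mul_of_dvd_left ?_ _)) (dvd_mul_of_dvd_left ?_ _)
    · rw [pow_add]; exact mul_dvd_mul hQν hβ
    · have := mul_dvd_mul (pow_dvd_pow (2 : ℤ) (show 1 + M ≤ 1 + b by omega)) h3
      rwa [← pow_add, show 1 + M + padicValNat 2 e = 1 + padicValNat 2 e + M by omega] at this
    · have := mul_dvd_mul_left (2 : ℤ) (mul_dvd_mul_left ((2 : ℤ) ^ M) h3)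
      rwa [← pow_add, ← pow_succ',
        show M + padicValNat 2 e + 1 = 1 + padicValNat 2 e + M by omega] at this
  -- The part proportional to `j'` vanishes: for `j'` odd, `Q ≡ 2` modulo `4`, so `ν` is the
  -- valuation of `e`, and `m` is killed by both `2` and `e`.
  have h2 : (2 : ℤ) ^ M ∣ 2 ^ ν * j' * m := by
    rcases Nat.even_or_odd j' with hj' | hj'
    · exact heven _ (dvd_mul_of_dvd_right (by exact_mod_cast hj'.two_dvd) _)
    have hQ4 : 4 ∣ Q + 2 := by
      have h4 : (4 : ℤ) ∣ t ^ j - 1 := by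
        rw [← hS]; exact dvd_mul_of_dvd_right ht4 _
      have h5 : (4 : ℤ) ∣ Q - ((-1) ^ j' * t ^ j - 1) :=
        (pow_dvd_pow 2 (show 2 ≤ 1 + b by omega)).trans hcong
      rw [hj'.neg_one_pow] at h5
      have := dvd_sub h5 h4
      omega
    have hQ0 : Q ≠ 0 := by omega
    have hv : padicValInt 2 Q = 1 := by
      have h6 := (padicValInt_dvd_iff (p := 2) 1 Q).1 (by norm_num; omega)
      have h7 := mt (padicValInt_dvd_iff (p := 2) 2 Q).2 (by norm_num; omega)
      omega
    rcases Nat.eq_zero_or_pos ν with h0 | h0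
    · have he2 : ¬ 2 ∣ e := by
        intro hd
        have := one_le_padicValNat_of_dvd he hd
        omega
      have : (2 : ℤ) ^ M ∣ m := by
        obtain ⟨l, hl⟩ : ∃ l, e = 2 * l + 1 := ⟨e / 2, by omega⟩
        have h8 : m = e * m - l * (2 * m) := by rw [hl]; push_cast; ring
        rw [h8]; exact dvd_sub hem (dvd_mul_of_dvd_right h2m _)
      exact dvd_mul_of_dvd_right this _
    · exact heven _ (dvd_mul_of_dvd_left (dvd_pow_self _ h0.ne') _)
  have key : 2 ^ ν * (γ * k - (ε * (S * β') + T * β)) - (2 ^ ν * (j + j') : ℕ) * m =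
      2 ^ ν * (γ * k - (ε * (S * β') + T * β) - j * m) - 2 ^ ν * j' * m := by
    push_cast
    ring
  rw [key]
  exact dvd_sub h1 h2

theorem two_dvd_geom_sum_sub {t : ℤ} (ht : 2 ∣ t - 1) (j : ℕ) :
    2 ∣ (∑ i ∈ Finset.range j, t ^ i) - j := by
  have h : ((∑ i ∈ Finset.range j, t ^ i) - j : ℤ) = ∑ i ∈ Finset.range j, (t ^ i - 1) := by
    simp
  rw [h]
  exact Finset.dvd_sum fun i _ => ht.trans (sub_one_dvd_pow_sub_one t i)

/-! ### Commutators up to roots of unity -/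

section Group

variable {U : Type*} [Group U] {ω x y z : U} {t : ℤ}

theorem conj_zpow_of_conj (h : y * ω * y⁻¹ = ω ^ t) (k : ℤ) : y * ω ^ k * y⁻¹ = ω ^ (t * k) := by
  rw [← conj_zpow, h, zpow_mul]

theorem conj_pow_of_conj (h : y * ω * y⁻¹ = ω ^ t) (j : ℕ) :
    y ^ j * ω * (y ^ j)⁻¹ = ω ^ t ^ j := by
  induction j with
  | zero => simp
  | succ j ih =>
    rw [pow_succ', mul_inv_rev, show y * y ^ j * ω * ((y ^ j)⁻¹ * y⁻¹) =
      y * (y ^ j * ω * (y ^ j)⁻¹) * y⁻¹ by group, ih, conj_zpow_of_conj h, pow_succ']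

/-- If `y` raises `ω` to the power `t` and multiplies `x` by `ω ^ β`, then `y ^ j` multiplies `x`
by `ω ^ (β (1 + t + ⋯ + t ^ (j - 1)))`. -/
theorem conj_pow_of_conj_mul {β : ℤ} (h : y * ω * y⁻¹ = ω ^ t) (hx : y * x * y⁻¹ = ω ^ β * x)
    (j : ℕ) :
    y ^ j * x * (y ^ j)⁻¹ = ω ^ ((∑ i ∈ Finset.range j, t ^ i) * β) * x := by
  induction j with
  | zero => simp
  | succ j ih =>
    rw [pow_succ', mul_inv_rev, show y * y ^ j * x * ((y ^ j)⁻¹ * y⁻¹) =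
      y * (y ^ j * x * (y ^ j)⁻¹) * y⁻¹ by group, ih,
      show y * (ω ^ ((∑ i ∈ Finset.range j, t ^ i) * β) * x) * y⁻¹ =
      (y * ω ^ ((∑ i ∈ Finset.range j, t ^ i) * β) * y⁻¹) * (y * x * y⁻¹) by group,
      conj_zpow_of_conj h, hx, ← mul_assoc, ← zpow_add]
    congr 2
    rw [Finset.sum_range_succ', ← Finset.sum_congr rfl fun i _ => (pow_succ' t i).symm,
      ← Finset.mul_sum]
    ring

theorem conj_mul_of_conj_mul {β β' : ℤ} {x' : U} (hc : Commute x ω)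
    (hx : y * x * y⁻¹ = ω ^ β * x) (hx' : y * x' * y⁻¹ = ω ^ β' * x') :
    y * (x * x') * y⁻¹ = ω ^ (β + β') * (x * x') := by
  rw [show y * (x * x') * y⁻¹ = (y * x * y⁻¹) * (y * x' * y⁻¹) by group, hx, hx', zpow_add,
    mul_assoc, mul_assoc, ← mul_assoc x, (hc.zpow_right β').eq, mul_assoc]

theorem commutator_of_conj {β : ℤ} (hx : y * x * y⁻¹ = ω ^ β * x) :
    ⁅x, y⁆ = ω ^ (-β) := by
  rw [commutatorElement_def, show x * y * x⁻¹ * y⁻¹ = x * (y * x * y⁻¹)⁻¹ by group, hx,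
    mul_inv_rev, mul_inv_cancel_left, zpow_neg]

theorem commutator_of_conj' {β : ℤ} (hx : y * x * y⁻¹ = ω ^ β * x) : ⁅y, x⁆ = ω ^ β := by
  rw [commutatorElement_def, hx, mul_inv_cancel_right]

/-- If `y` raises `ω` to the power `t` and multiplies `x` by `ω ^ β`, and `x ^ e = ω ^ γ`, then
`ω ^ (e β) = ω ^ ((t - 1) γ)`. -/
theorem orderOf_dvd_of_conj_pow {β γ : ℤ} {e : ℕ} (h : y * ω * y⁻¹ = ω ^ t) (hc : Commute x ω)
    (hx : y * x * y⁻¹ = ω ^ β * x) (hγ : x ^ e = ω ^ γ) :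
    (orderOf ω : ℤ) ∣ e * β - (t - 1) * γ := by
  rw [orderOf_dvd_iff_zpow_eq_one]
  have h1 : ω ^ (t * γ) = ω ^ (β * e) * ω ^ γ := by
    rw [← conj_zpow_of_conj h, ← hγ, ← conj_pow, hx, ((hc.zpow_right β).symm).mul_pow, zpow_mul,
      zpow_natCast]
  rw [show (e * β - (t - 1) * γ : ℤ) = β * e + γ - t * γ by ring, zpow_sub, zpow_add, h1,
    mul_inv_cancel]

/-- The commutator of `x` with a power of `y`, corrected by a power of `x ^ e`, when `y` raises
`ω` to a power `t` with `v_p (t - 1) = a`. -/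
theorem commutator_pow_mul_pow_eq_one {p : ℕ} (hp : p.Prime) {M a b e ν j k : ℕ} {β γ Q : ℤ}
    (hω : orderOf ω = p ^ M) (h : y * ω * y⁻¹ = ω ^ t) (hc : Commute x ω)
    (hx : y * x * y⁻¹ = ω ^ β * x) (hγ : x ^ e = ω ^ γ)
    (he : e ≠ 0) (ht : t - 1 ≠ 0) (hta : padicValInt p (t - 1) = a) (hM : M ≤ b)
    (hQ : Q = e * k) (hcong : (p : ℤ) ^ (a + b) ∣ Q - (t ^ j - 1))
    (hν : (p : ℤ) ^ (a + padicValNat p e) ∣ p ^ ν * Q) :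
    (⁅x, y ^ j⁆ * (x ^ e) ^ k) ^ p ^ ν = 1 := by
  have hrel := orderOf_dvd_of_conj_pow h hc hx hγ
  rw [hω] at hrel
  push_cast at hrel
  have := pow_dvd_exponent_of_cyclic hp he ht hta hM hQ (geom_sum_mul t j) hcong hrel hν
  rw [commutator_of_conj (conj_pow_of_conj_mul h hx j), hγ, ← zpow_natCast (ω ^ γ), ← zpow_mul,
    ← zpow_add, ← zpow_natCast, ← zpow_mul, ← orderOf_dvd_iff_zpow_eq_one, hω]
  push_cast
  convert this using 1
  ring

/-- The invariant `⁅R, x⁆ ^ d * ⁅S, x⁆⁻¹` of an element `x` with respect to `R`, `S` and `d`. For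
`R = u_ρ`, `S = u_σ`, `x = u_c` and `d = (1 - t) / 2` it is the element `μ` attached to `c`. -/
def commutatorInvariant (R S : U) (d : ℤ) (x : U) : U := ⁅R, x⁆ ^ d * ⁅S, x⁆⁻¹

/-- `x` commutes with `ω` and is multiplied by `ω ^ β` and `ω ^ β'` under conjugation by
`R` and `S`. -/
structure ConjBy (ω R S x : U) (β β' : ℤ) : Prop where
  commute : Commute x ω
  left : R * x * R⁻¹ = ω ^ β * x
  right : S * x * S⁻¹ = ω ^ β' * x

namespace ConjBy

variable {R S : U} {d β β' γ γ' : ℤ}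

theorem commutatorInvariant (h : ConjBy ω R S x β β') :
    commutatorInvariant R S d x = ω ^ (d * β - β') := by
  rw [CyclotomicAlgebra.commutatorInvariant, commutator_of_conj' h.left,
    commutator_of_conj' h.right, ← zpow_mul, zpow_sub, mul_comm β]

theorem one : ConjBy ω R S 1 0 0 := ⟨Commute.one_left _, by simp, by simp⟩

theorem mul (h : ConjBy ω R S x β β') (h' : ConjBy ω R S y γ γ') :
    ConjBy ω R S (x * y) (β + γ) (β' + γ') :=
  ⟨h.commute.mul_left h'.commute, conj_mul_of_conj_mul h.commute h.left h'.left,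
    conj_mul_of_conj_mul h.commute h.right h'.right⟩

theorem pow (h : ConjBy ω R S x β β') (k : ℕ) : ConjBy ω R S (x ^ k) (k * β) (k * β') := by
  induction k with
  | zero => simpa using one
  | succ k ih =>
    rw [pow_succ]
    convert ih.mul h using 1 <;> push_cast <;> ring

/-- A power of `ω` has exponents `-2 k` and `(t - 1) k`, and hence trivial invariant when
`2 d = 1 - t`. -/
theorem zpow_self (hR : R * ω * R⁻¹ = ω ^ (-1 : ℤ)) (hS : S * ω * S⁻¹ = ω ^ t) (k : ℤ) :
    ConjBy ω R S (ω ^ k) (-2 * k) ((t - 1) * k) := by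
  refine ⟨(Commute.refl ω).zpow_left k, ?_, ?_⟩
  · rw [conj_zpow_of_conj hR, ← zpow_add]; ring_nf
  · rw [conj_zpow_of_conj hS, ← zpow_add]; ring_nf

/-- The invariant is multiplicative on products of powers of elements with known exponents. -/
theorem listProd {ι : Type*} (l : List ι) (f : ι → U) (s : ι → ℕ) (a a' : ι → ℤ)
    (h : ∀ i, ConjBy ω R S (f i) (a i) (a' i)) :
    ∃ A A', ConjBy ω R S (l.map fun i => f i ^ s i).prod A A' ∧
      ∀ K : ℕ, ω ^ (K * (d * A - A')) =
        (l.map fun i => (ω ^ (d * a i - a' i)) ^ (K * s i)).prod := by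
  induction l with
  | nil => exact ⟨0, 0, by simpa using one, by simp⟩
  | cons i l ih =>
    obtain ⟨A, A', h1, h2⟩ := ih
    refine ⟨s i * a i + A, s i * a' i + A', ?_, fun K => ?_⟩
    · rw [List.map_cons, List.prod_cons]
      exact ((h i).pow (s i)).mul h1
    · rw [List.map_cons, List.prod_cons, ← h2, ← zpow_natCast (ω ^ _), ← zpow_mul, ← zpow_add]
      push_cast
      ring_nf

/-- The square of `R` has trivial invariant when `R` and `S` commute up to a power of `ω`. -/
theorem sq (hR : R * ω * R⁻¹ = ω ^ (-1 : ℤ)) {w : ℤ}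
    (hSR : S * R * S⁻¹ = ω ^ w * R) : ConjBy ω R S (R ^ 2) 0 0 := by
  have hR' := conj_pow_of_conj hR 2
  refine ⟨?_, ?_, ?_⟩
  · rw [mul_inv_eq_iff_eq_mul] at hR'
    simpa [Commute, SemiconjBy] using hR'
  · rw [zpow_zero, one_mul]; group
  · have h1 := conj_zpow_of_conj hR w
    rw [mul_inv_eq_iff_eq_mul] at h1
    rw [← conj_pow, hSR, zpow_zero, one_mul, pow_two, mul_assoc, ← mul_assoc R, h1, pow_two,
      mul_assoc, ← mul_assoc, ← zpow_add]
    simp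

/-- As `S R` and `R S` differ by a power of `ω`, they conjugate `x` in the same way; comparing the
results relates the exponents of `x`. -/
theorem orderOf_dvd (h : ConjBy ω R S x β β') (hR : R * ω * R⁻¹ = ω ^ (-1 : ℤ))
    (hS : S * ω * S⁻¹ = ω ^ t) {w : ℤ} (hSR : S * R * S⁻¹ = ω ^ w * R) :
    (orderOf ω : ℤ) ∣ 2 * β' - (1 - t) * β := by
  rw [orderOf_dvd_iff_zpow_eq_one]
  have h1 : S * R * x * (S * R)⁻¹ = ω ^ (t * β + β') * x := by
    rw [show S * R * x * (S * R)⁻¹ = S * (R * x * R⁻¹) * S⁻¹ by group, h.left,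
      show S * (ω ^ β * x) * S⁻¹ = S * ω ^ β * S⁻¹ * (S * x * S⁻¹) by group,
      conj_zpow_of_conj hS, h.right, zpow_add, mul_assoc]
  have h2 : R * S * x * (R * S)⁻¹ = ω ^ (-β' + β) * x := by
    rw [show R * S * x * (R * S)⁻¹ = R * (S * x * S⁻¹) * R⁻¹ by group, h.right,
      show R * (ω ^ β' * x) * R⁻¹ = R * ω ^ β' * R⁻¹ * (R * x * R⁻¹) by group,
      conj_zpow_of_conj hR, h.left, zpow_add, mul_assoc, neg_one_mul]
  have h3 : S * R = ω ^ w * (R * S) := by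
    rw [mul_inv_eq_iff_eq_mul] at hSR
    rw [hSR, mul_assoc]
  have h4 : S * R * x * (S * R)⁻¹ = ω ^ (-β' + β) * x := by
    rw [h3, show ω ^ w * (R * S) * x * (ω ^ w * (R * S))⁻¹ =
      ω ^ w * (R * S * x * (R * S)⁻¹) * (ω ^ w)⁻¹ by group, h2, ← mul_assoc, ← zpow_add,
      mul_assoc, ((h.commute.zpow_right w).inv_right).eq, ← mul_assoc, ← zpow_neg, ← zpow_add]
    congr 2; ring
  have h5 : ω ^ (t * β + β') = ω ^ (-β' + β) := mul_right_cancel (h1.symm.trans h4)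
  rw [show 2 * β' - (1 - t) * β = (t * β + β') - (-β' + β) by ring, zpow_sub, h5, mul_inv_cancel]

/-- The commutator of `x` with `R ^ j' * S ^ j`, corrected by a power of `x ^ e`, when `R` and `S`
raise the `2`-power root of unity `ω` to the powers `-1` and `t ≡ 1` modulo `4`. -/
theorem commutator_pow_mul_pow_eq (h : ConjBy ω R S x β β') {M b e ν j j' k : ℕ} {Q : ℤ}
    (hω : orderOf ω = 2 ^ M) (hR : R * ω * R⁻¹ = ω ^ (-1 : ℤ)) (hS : S * ω * S⁻¹ = ω ^ t)
    {w : ℤ} (hSR : S * R * S⁻¹ = ω ^ w * R) (hγ : x ^ e = ω ^ γ)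
    (he : e ≠ 0) (ht : 1 - t = 2 * d) (ht4 : 4 ∣ t - 1) (hM : M ≤ b) (hb : 1 ≤ b)
    (hQ : Q = e * k)
    (hcong : (2 : ℤ) ^ (1 + b) ∣ Q - ((-1) ^ j' * t ^ j - 1))
    (hν : ν = 1 + padicValNat 2 e - padicValInt 2 Q) :
    (⁅x, R ^ j' * S ^ j⁆ * (x ^ e) ^ k) ^ 2 ^ ν =
      ω ^ ((2 ^ ν * (j + j') : ℕ) * (d * β - β')) := by
  have hβ := orderOf_dvd_of_conj_pow hR h.commute h.left hγ
  have hβ' := orderOf_dvd_of_conj_pow hS h.commute h.right hγ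
  have hββ' := h.orderOf_dvd hR hS hSR
  rw [hω] at hβ hβ' hββ'
  push_cast at hβ hβ' hββ'
  have key := pow_dvd_exponent_of_not_cyclic he ht ht4 hM hb hQ (geom_sum_mul t j)
    (two_dvd_geom_sum_sub (dvd_trans (by norm_num) ht4) j) (geom_sum_mul (-1 : ℤ) j') hcong
    hβ hβ' hββ' hν
  have h1 : R ^ j' * S ^ j * x * (R ^ j' * S ^ j)⁻¹ =
      ω ^ ((-1) ^ j' * ((∑ i ∈ Finset.range j, t ^ i) * β') +
        (∑ i ∈ Finset.range j', (-1) ^ i) * β) * x := by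
    rw [show R ^ j' * S ^ j * x * (R ^ j' * S ^ j)⁻¹ =
      R ^ j' * (S ^ j * x * (S ^ j)⁻¹) * (R ^ j')⁻¹ by group, conj_pow_of_conj_mul hS h.right,
      show ∀ v, R ^ j' * (v * x) * (R ^ j')⁻¹ =
        R ^ j' * v * (R ^ j')⁻¹ * (R ^ j' * x * (R ^ j')⁻¹) by intro v; group,
      conj_zpow_of_conj (conj_pow_of_conj hR j'), conj_pow_of_conj_mul hR h.left, zpow_add,
      mul_assoc]
  rw [commutator_of_conj h1, hγ, ← zpow_natCast (ω ^ γ), ← zpow_mul, ← zpow_add,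
    ← zpow_natCast, ← zpow_mul]
  rw [← mul_inv_eq_one, ← zpow_neg, ← zpow_add, ← orderOf_dvd_iff_zpow_eq_one, hω]
  push_cast
  push_cast at key
  convert key using 1
  ring

end ConjBy

end Group

end

/-! ### Roots of unity in `K` and its conductor -/

section

theorem isPrimitiveRoot_zeta {n : ℕ} (hn : n ≠ 0) : IsPrimitiveRoot (zeta n) n :=
  Complex.isPrimitiveRoot_exp n hn

theorem zeta_mem_of_isPrimitiveRoot {k : Type*} [Field k] [Algebra k ℂ] (L : IntermediateField k ℂ)
    {n : ℕ} (hn : n ≠ 0) {x : ℂ} (hx : IsPrimitiveRoot x n) (h : x ∈ L) : zeta n ∈ L := by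
  have := NeZero.mk hn
  obtain ⟨i, -, hi⟩ := hx.eq_pow_of_pow_eq_one (isPrimitiveRoot_zeta hn).pow_eq_one
  exact hi ▸ pow_mem h i

theorem zeta_mem_of_dvd {k : Type*} [Field k] [Algebra k ℂ] (L : IntermediateField k ℂ)
    {d n : ℕ} (hn : n ≠ 0) (hd : d ∣ n) (h : zeta n ∈ L) : zeta d ∈ L := by
  obtain ⟨l, rfl⟩ := hd
  exact zeta_mem_of_isPrimitiveRoot L (left_ne_zero_of_mul hn)
    ((isPrimitiveRoot_zeta hn).pow (Nat.pos_of_ne_zero hn) (mul_comm _ _)) (pow_mem h l)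

theorem zeta_mul_mem {k : Type*} [Field k] [Algebra k ℂ] (L : IntermediateField k ℂ)
    {x y : ℕ} (hx : x ≠ 0) (hy : y ≠ 0) (hxy : x.Coprime y) (h : zeta x ∈ L) (h' : zeta y ∈ L) :
    zeta (x * y) ∈ L := by
  refine zeta_mem_of_isPrimitiveRoot L (mul_ne_zero hx hy) (x := zeta x * zeta y) ?_ (mul_mem h h')
  have h1 := isPrimitiveRoot_zeta hx
  have h2 := isPrimitiveRoot_zeta hy
  have := IsPrimitiveRoot.orderOf (zeta x * zeta y)
  rwa [(Commute.all _ _).orderOf_mul_eq_mul_orderOf_of_coprime (by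
    rwa [← h1.eq_orderOf, ← h2.eq_orderOf]), ← h1.eq_orderOf, ← h2.eq_orderOf] at this

theorem zeta_mem_cyclotomic (n : ℕ) : zeta n ∈ cyclotomic n :=
  IntermediateField.mem_adjoin_simple_self ℚ _

theorem cyclotomic_le {L : IntermediateField ℚ ℂ} {n : ℕ} (h : zeta n ∈ L) : cyclotomic n ≤ L :=
  IntermediateField.adjoin_simple_le_iff.2 h

theorem isCyclotomicExtension_adjoin_zeta (k : Type*) [Field k] [Algebra k ℂ] {n : ℕ}
    (hn : n ≠ 0) : IsCyclotomicExtension {n} k (IntermediateField.adjoin k {zeta n}) := by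
  have := NeZero.mk hn
  have h := isPrimitiveRoot_zeta hn
  change IsCyclotomicExtension {n} k (IntermediateField.adjoin k {zeta n}).toSubalgebra
  rw [IntermediateField.adjoin_simple_toSubalgebra_of_isAlgebraic
    (h.isIntegral (NeZero.pos n)).tower_top.isAlgebraic]
  exact h.adjoin_isCyclotomicExtension k

theorem isCyclotomicExtension_cyclotomic {n : ℕ} (hn : n ≠ 0) :
    IsCyclotomicExtension {n} ℚ (cyclotomic n) :=
  isCyclotomicExtension_adjoin_zeta ℚ hn

theorem finiteDimensional_cyclotomic {n : ℕ} (hn : n ≠ 0) :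
    FiniteDimensional ℚ (cyclotomic n) := by
  have := isCyclotomicExtension_cyclotomic hn
  exact IsCyclotomicExtension.finiteDimensional {n} ℚ _

theorem finrank_cyclotomic {n : ℕ} (hn : n ≠ 0) :
    Module.finrank ℚ (cyclotomic n) = n.totient := by
  have := isCyclotomicExtension_cyclotomic hn
  have := NeZero.mk hn
  exact IsCyclotomicExtension.finrank _ (Polynomial.cyclotomic.irreducible_rat (NeZero.pos n))

theorem lcm_totient_le_of_zeta_mem {l n : ℕ} (hn : n ≠ 0) (hl : l ≠ 0)
    (h : zeta l ∈ cyclotomic n) : (l.lcm n).totient ≤ n.totient := by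
  have := finiteDimensional_cyclotomic hn
  rw [← finrank_cyclotomic hn]
  have h1 : IsPrimitiveRoot (⟨zeta l, h⟩ : cyclotomic n) l :=
    IsPrimitiveRoot.coe_submonoidClass_iff.1 (isPrimitiveRoot_zeta hl)
  have h2 : IsPrimitiveRoot (⟨zeta n, zeta_mem_cyclotomic n⟩ : cyclotomic n) n :=
    IsPrimitiveRoot.coe_submonoidClass_iff.1 (isPrimitiveRoot_zeta hn)
  exact h1.lcm_totient_le_finrank h2
    (Polynomial.cyclotomic.irreducible_rat (Nat.lcm_pos (by omega) (by omega)))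

theorem dvd_two_mul_of_zeta_mem {l n : ℕ} (hn : n ≠ 0) (hl : l ≠ 0)
    (h : zeta l ∈ cyclotomic n) : l ∣ 2 * n := by
  have := isCyclotomicExtension_cyclotomic hn
  have := NeZero.mk hn
  have : NumberField (cyclotomic n) := IsCyclotomicExtension.numberField {n} ℚ _
  have h1 : IsPrimitiveRoot (⟨zeta l, h⟩ : cyclotomic n) l :=
    IsPrimitiveRoot.coe_submonoidClass_iff.1 (isPrimitiveRoot_zeta hl)
  exact h1.dvd_of_isCyclotomicExtension n hl

variable {K : IntermediateField ℚ ℂ} (hK : IsAbelianNumberField K)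
include hK

theorem mK_spec : 0 < mK K ∧ Even (mK K) ∧ K ≤ cyclotomic (mK K) := by
  obtain ⟨n, hn, h⟩ := hK
  refine Nat.sInf_mem (s := {m | 0 < m ∧ Even m ∧ K ≤ cyclotomic m})
    ⟨2 * n, by positivity, even_two_mul n, h.trans (cyclotomic_le ?_)⟩
  exact zeta_mem_of_dvd _ (by positivity) (dvd_mul_left n 2) (zeta_mem_cyclotomic _)

omit hK in
theorem mK_le {n : ℕ} (hn : 0 < n) (he : Even n) (h : K ≤ cyclotomic n) : mK K ≤ n :=
  Nat.sInf_le ⟨hn, he, h⟩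

theorem numberField_of_isAbelianNumberField : NumberField K := by
  have := finiteDimensional_cyclotomic (mK_spec hK).1.ne'
  have : FiniteDimensional ℚ K :=
    FiniteDimensional.of_injective (IntermediateField.inclusion (mK_spec hK).2.2).toLinearMap
      (IntermediateField.inclusion (mK_spec hK).2.2).injective
  exact ⟨⟩

variable {p : ℕ} (hp : p.Prime)
include hp

theorem bddAbove_zeta_pow_mem : BddAbove {x | zeta (p ^ x) ∈ K} := by
  refine ⟨2 * mK K, fun x hx => ?_⟩
  have hm := mK_spec hK
  have h := dvd_two_mul_of_zeta_mem hm.1.ne' (pow_ne_zero x hp.ne_zero) (hm.2.2 hx)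
  exact (x.lt_pow_self hp.one_lt).le.trans (Nat.le_of_dvd (by omega) h)

theorem zeta_pow_aK_mem : zeta (p ^ aK K p) ∈ K :=
  Nat.sSup_mem (s := {x | zeta (p ^ x) ∈ K}) ⟨0, by simp [zeta]⟩ (bddAbove_zeta_pow_mem hK hp)

theorem le_aK {x : ℕ} (h : zeta (p ^ x) ∈ K) : x ≤ aK K p :=
  le_csSup (bddAbove_zeta_pow_mem hK hp) h

theorem one_le_aK (hpK : zeta p ∈ K) : 1 ≤ aK K p :=
  le_aK hK hp (by simpa using hpK)

theorem dvd_mK (hpK : zeta p ∈ K) : p ∣ mK K := by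
  have hm := mK_spec hK
  have h := dvd_two_mul_of_zeta_mem hm.1.ne' hp.ne_zero (hm.2.2 hpK)
  rcases (Nat.Prime.dvd_mul hp).1 h with h | h
  · rw [(Nat.prime_dvd_prime_iff_eq hp Nat.prime_two).1 h]
    exact hm.2.1.two_dvd
  · exact h

theorem one_le_sK (hpK : zeta p ∈ K) : 1 ≤ sK K p := by
  have := Fact.mk hp
  exact one_le_padicValNat_of_dvd (mK_spec hK).1.ne' (dvd_mK hK hp hpK)

omit hK hp in
theorem sK_le_bK : sK K p ≤ bK K p := by
  unfold bK
  split_ifs <;> omega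

omit hK hp in
theorem sK_lt_bK (hp2 : ¬ Odd p) (h4 : zeta 4 ∉ K) : sK K p < bK K p := by
  unfold bK
  rw [if_neg (by tauto)]
  split_ifs <;> omega

omit hp in
/-- When `p ^ s = 2`, the conductor is twice an odd number and `ζ_4` does not lie in `K`. -/
theorem two_le_bK (hs : p ^ sK K p = 2) : p = 2 ∧ 2 ≤ bK K p := by
  have h1 : sK K p ≠ 0 := by intro h; simp [h] at hs
  obtain rfl : p = 2 := by
    rcases (Nat.dvd_prime Nat.prime_two).1 (hs ▸ dvd_pow_self p h1) with h | h
    · simp [h] at hs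
    · exact h
  refine ⟨rfl, ?_⟩
  have hs1 : sK K 2 = 1 := Nat.pow_right_injective le_rfl (by simpa using hs)
  have hm := mK_spec hK
  suffices h4 : zeta 4 ∉ K by
    have := sK_lt_bK (K := K) (p := 2) (by decide) h4
    omega
  intro h4
  have h := lcm_totient_le_of_zeta_mem hm.1.ne' (by norm_num) (hm.2.2 h4)
  obtain ⟨l, hl⟩ := hm.2.1.two_dvd
  have hl2 : ¬ 2 ∣ l := by
    rintro ⟨l', rfl⟩
    have : 2 ≤ padicValNat 2 (mK K) :=
      (padicValNat_dvd_iff_le hm.1.ne').1 ⟨l', by rw [hl]; ring⟩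
    rw [sK] at hs1
    omega
  have hodd : Odd l := Nat.not_even_iff_odd.1 fun h => hl2 h.two_dvd
  have hlcm : Nat.lcm 4 (2 * l) = 2 * (2 * l) := by
    rw [show 4 = 2 * 2 from rfl, Nat.lcm_mul_left, (Nat.coprime_two_left.2 hodd).lcm_eq_mul]
  rw [hl, hlcm, Nat.totient_two_mul_of_even (even_two_mul l), Nat.totient_two_mul_of_odd hodd] at h
  have := Nat.totient_pos.2 (show 0 < l by have := hm.1; omega)
  omega

end

/-! ### Inertia groups -/

section

/-- The inertia group at a prime over `r` fixes the roots of unity of order prime to `r`. -/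
theorem apply_eq_self_of_mem_inertia {k E : Type*} [Field k] [Field E] [Algebra k E]
    {R : Ideal (𝓞 E)} (hR : R.IsPrime) {r : ℕ} (hr : (r : 𝓞 E) ∈ R) {θ : Gal(E/k)}
    (hθ : θ ∈ R.inertia Gal(E/k)) {n : ℕ} (hn : n.Coprime r) {x : E} (hx : x ^ n = 1) :
    θ x = x := by
  rcases Nat.eq_zero_or_pos n with rfl | hn0
  · -- `r = 1` does not lie in a proper ideal.
    rw [Nat.coprime_zero_left] at hn
    rw [hn, Nat.cast_one] at hr
    exact absurd ((Ideal.eq_top_iff_one R).2 hr) hR.ne_top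
  have hx0 : x ≠ 0 := by rintro rfl; simp [hn0.ne'] at hx
  by_contra hne
  have hxi : IsIntegral ℤ x := ⟨Polynomial.X ^ n - 1, Polynomial.monic_X_pow_sub_C 1 hn0.ne',
    by simp [hx]⟩
  obtain ⟨X, hX⟩ : ∃ X : 𝓞 E, (X : E) = x := ⟨⟨x, hxi⟩, rfl⟩
  have h1 : θ • X - X ∈ R := hθ X
  have hXn : X ^ n = 1 := by
    apply NumberField.RingOfIntegers.ext
    simp [hX, hx]
  -- The quotient `Y` of `θ x` by `x` is a root of unity congruent to `1` modulo `R`.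
  set Y : 𝓞 E := θ • X * X ^ (n - 1) with hY
  have hYR : Y - 1 ∈ R := by
    have : Y - 1 = (θ • X - X) * X ^ (n - 1) := by
      rw [hY, sub_mul, ← pow_succ', Nat.sub_add_cancel hn0, hXn]
    rw [this]; exact R.mul_mem_right _ h1
  have hYn : Y ^ n = 1 := by
    rw [hY, mul_pow, ← smul_pow', hXn, smul_one, one_mul, ← pow_mul, mul_comm, pow_mul, hXn,
      one_pow]
  have hY1 : Y - 1 ≠ 0 := by
    intro h
    apply hne
    have h2 : θ • X * (X ^ (n - 1) * X) = X := by
      rw [← mul_assoc, ← hY, sub_eq_zero.1 h, one_mul]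
    rw [← pow_succ, Nat.sub_add_cancel hn0, hXn, mul_one] at h2
    have h3 := congrArg (fun z : 𝓞 E => (z : E)) h2
    rw [← hX]
    exact h3
  have hgeom : ∑ i ∈ Finset.range n, Y ^ i = 0 := by
    have := geom_sum_mul Y n
    rw [hYn, sub_self] at this
    exact (mul_eq_zero.1 this).resolve_right hY1
  have hnR : (n : 𝓞 E) ∈ R := by
    have h4 : (n : 𝓞 E) = -∑ i ∈ Finset.range n, (Y ^ i - 1) := by
      rw [Finset.sum_sub_distrib, hgeom]; simp
    rw [h4]
    refine R.neg_mem (R.sum_mem fun i _ => ?_)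
    exact R.mem_of_dvd (sub_one_dvd_pow_sub_one Y i) hYR
  apply hR.ne_top
  rw [Ideal.eq_top_iff_one]
  obtain ⟨u, v, huv⟩ := Nat.isCoprime_iff_coprime.2 hn
  have h5 := congrArg (Int.cast : ℤ → 𝓞 E) huv.symm
  push_cast at h5
  rw [h5]
  exact R.add_mem (R.mul_mem_left _ hnR) (R.mul_mem_left _ hr)

/-- An element of the inertia group of `E/K` acts on a Galois subextension `L/K` through the
inertia group of `L/K`, whose order is the ramification index. -/
theorem restrictNormal_pow_ramificationIdxIn {k L E : Type*} [Field k] [Field L] [Field E]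
    [NumberField k] [NumberField L] [Algebra k L] [Algebra k E] [Algebra L E]
    [IsScalarTower k L E] [IsGalois k L] {R : Ideal (𝓞 E)} (hR : R.IsPrime)
    (hk : R.under (𝓞 k) ≠ ⊥) {θ : Gal(E/k)} (hθ : θ ∈ R.inertia Gal(E/k)) :
    θ.restrictNormal L ^ Ideal.ramificationIdxIn (R.under (𝓞 k)) (𝓞 L) = 1 := by
  have : (R.under (𝓞 k)).IsMaximal := Ideal.IsPrime.isMaximal inferInstance hk
  have hlies : (R.under (𝓞 L)).LiesOver (R.under (𝓞 k)) := by
    refine ⟨?_⟩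
    rw [Ideal.under_under]
  rw [← Ideal.card_inertia_eq_ramificationIdxIn (G := Gal(L/k)) (R.under (𝓞 k)) (R.under (𝓞 L))]
  have hmem : θ.restrictNormal L ∈ (R.under (𝓞 L)).inertia Gal(L/k) := by
    intro x
    have h1 : algebraMap (𝓞 L) (𝓞 E) (θ.restrictNormal L • x - x) =
        θ • algebraMap (𝓞 L) (𝓞 E) x - algebraMap (𝓞 L) (𝓞 E) x := by
      rw [map_sub]
      congr 1
      apply NumberField.RingOfIntegers.ext
      exact AlgEquiv.restrictNormal_commutes θ L (x : L)
    change algebraMap (𝓞 L) (𝓞 E) (θ.restrictNormal L • x - x) ∈ R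
    rw [h1]
    exact hθ _
  exact congrArg Subtype.val
    (pow_card_eq_one' (x := (⟨_, hmem⟩ : (R.under (𝓞 L)).inertia Gal(L/k))))

theorem ramificationIdxIn_dvd_card_gal {k L : Type*} [Field k] [Field L]
    [NumberField k] [NumberField L] [Algebra k L] [IsGalois k L] (P : Ideal (𝓞 k)) [P.IsPrime] :
    Ideal.ramificationIdxIn P (𝓞 L) ∣ Nat.card Gal(L/k) := by
  rw [← Ideal.ncard_primesOver_mul_ramificationIdxIn_mul_inertiaDegIn P (𝓞 L) Gal(L/k)]
  exact dvd_mul_of_dvd_right (dvd_mul_right _ _) _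

variable {K : IntermediateField ℚ ℂ}

/-- The subfield of `ℂ` fixed by an automorphism `χ` of a subfield `E` of `ℂ`. -/
noncomputable def fixedLift {E : IntermediateField K ℂ} (χ : Gal(E/K)) : IntermediateField K ℂ :=
  IntermediateField.lift (IntermediateField.fixedField (Subgroup.zpowers χ))

theorem fixedLift_le {E : IntermediateField K ℂ} (χ : Gal(E/K)) : fixedLift χ ≤ E :=
  IntermediateField.lift_le _

theorem coe_mem_fixedLift {E : IntermediateField K ℂ} {χ : Gal(E/K)} {x : E} :
    (x : ℂ) ∈ fixedLift χ ↔ χ x = x := by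
  rw [fixedLift, IntermediateField.mem_lift]
  constructor
  · intro h
    exact h ⟨χ, Subgroup.mem_zpowers χ⟩
  · intro h
    rintro ⟨g, hg⟩
    have : Subgroup.zpowers χ ≤ MulAction.stabilizer Gal(E/K) x := by
      rw [Subgroup.zpowers_le]; exact h
    exact this hg

theorem fixedLift_le_fixedLift_pow {E : IntermediateField K ℂ} (χ : Gal(E/K)) (n : ℕ) :
    fixedLift χ ≤ fixedLift (χ ^ n) := by
  intro x hx
  obtain ⟨y, rfl⟩ : ∃ y : E, (y : ℂ) = x := ⟨⟨x, fixedLift_le χ hx⟩, rfl⟩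
  rw [coe_mem_fixedLift] at hx ⊢
  have h : χ ∈ MulAction.stabilizer Gal(E/K) y := hx
  exact pow_mem h n

theorem eq_one_of_le_fixedLift {E : IntermediateField K ℂ} {χ : Gal(E/K)} (h : E ≤ fixedLift χ) :
    χ = 1 :=
  AlgEquiv.ext fun x => coe_mem_fixedLift.1 (h x.2)

/-- An automorphism raises the roots of unity of order `n` to some power. -/
theorem exists_pow_of_isPrimitiveRoot {k E : Type*} [Field k] [Field E] [Algebra k E]
    (χ : Gal(E/k)) {n : ℕ} (hn : n ≠ 0) {x : E} (hx : IsPrimitiveRoot x n) :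
    ∃ u : ℕ, χ x = x ^ u := by
  have := NeZero.mk hn
  obtain ⟨i, -, hi⟩ := hx.eq_pow_of_pow_eq_one (show χ x ^ n = 1 by
    rw [← map_pow, hx.pow_eq_one, map_one])
  exact ⟨i, hi.symm⟩

theorem pow_apply_of_apply_eq_pow {k E : Type*} [Field k] [Field E] [Algebra k E]
    {χ : Gal(E/k)} {x : E} {u : ℕ} (h : χ x = x ^ u) (n : ℕ) : (χ ^ n) x = x ^ u ^ n := by
  induction n with
  | zero => simp
  | succ n ih => rw [pow_succ', AlgEquiv.mul_apply, ih, map_pow, h, ← pow_mul, pow_succ']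

/-- By minimality of the conductor `m`, an automorphism of `E/K` that fixes `ζ_{m/r}` fixes `ζ_m`
when `r` is an odd prime whose square divides `m`. -/
theorem zeta_mem_fixedLift_of_sq_dvd (hK : IsAbelianNumberField K) {E : IntermediateField K ℂ}
    {r l : ℕ} (hr : r.Prime) (hr2 : r ≠ 2) (hl : mK K = r * l)
    (hrl : r ∣ l) {χ : Gal(E/K)} (h : zeta l ∈ fixedLift χ) : zeta (mK K) ∈ fixedLift χ := by
  have hm := mK_spec hK
  have hl0 : l ≠ 0 := by rintro rfl; simp [hl] at hm
  set X : IntermediateField ℚ ℂ := (fixedLift χ).restrictScalars ℚ ⊓ cyclotomic (mK K) with hX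
  have hXm : X ≤ cyclotomic (mK K) := inf_le_right
  have hlm : cyclotomic l ≤ cyclotomic (mK K) :=
    cyclotomic_le (zeta_mem_of_dvd _ hm.1.ne' (hl ▸ dvd_mul_left l r) (zeta_mem_cyclotomic _))
  have hlX : cyclotomic l ≤ X := le_inf (cyclotomic_le h) hlm
  have hKX : K ≤ X := by
    refine le_inf (fun x hx => ?_) hm.2.2
    exact (fixedLift χ).algebraMap_mem ⟨x, hx⟩
  have := finiteDimensional_cyclotomic hl0
  have := finiteDimensional_cyclotomic hm.1.ne'
  obtain ⟨d, hd⟩ := IntermediateField.finrank_dvd_of_le_right hlX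
  obtain ⟨d', hd'⟩ := IntermediateField.finrank_dvd_of_le_right hXm
  rw [finrank_cyclotomic hl0] at hd
  rw [finrank_cyclotomic hm.1.ne', hl, Nat.totient_mul_of_prime_of_dvd hr hrl, hd, mul_comm r,
    mul_assoc] at hd'
  have hdd : r = d * d' :=
    Nat.eq_of_mul_eq_mul_left (Nat.totient_pos.2 (Nat.pos_of_ne_zero hl0)) hd'
  -- Since `ℚ(ζ_m)` has prime degree `r` over `ℚ(ζ_{m/r})`, the field `X` is one of the two.
  rcases (Nat.dvd_prime hr).1 ⟨d', hdd⟩ with h1 | h1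
  · exfalso
    have hfd : FiniteDimensional ℚ X :=
      FiniteDimensional.of_injective (IntermediateField.inclusion hXm).toLinearMap
        (IntermediateField.inclusion hXm).injective
    have heq : cyclotomic l = X := by
      refine IntermediateField.eq_of_le_of_finrank_eq hlX ?_
      rw [finrank_cyclotomic hl0, hd, h1, mul_one]
    have hle : Even l := by
      have := hm.2.1
      rw [hl, Nat.even_mul] at this
      exact this.resolve_left fun h2 => hr2 (hr.even_iff.1 h2)
    have := mK_le (Nat.pos_of_ne_zero hl0) hle (heq ▸ hKX)
    rw [hl] at this
    have := hr.two_le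
    nlinarith [Nat.pos_of_ne_zero hl0]
  · have heq : X = cyclotomic (mK K) := by
      refine IntermediateField.eq_of_le_of_finrank_eq hXm ?_
      rw [finrank_cyclotomic hm.1.ne', hl, Nat.totient_mul_of_prime_of_dvd hr hrl, hd, h1, mul_comm]
    have h2 : zeta (mK K) ∈ X := heq ▸ zeta_mem_cyclotomic _
    exact h2.1

/-- An automorphism of `E/K` that fixes `ζ_r` and the roots of unity of order prime to `r` in
`ℚ(ζ_m)` fixes `ζ_m`: otherwise one of its powers would fix `ζ_{m/r}` but not `ζ_m`. -/
theorem zeta_mem_fixedLift (hK : IsAbelianNumberField K) {E : IntermediateField K ℂ}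
    (hE : zeta (mK K) ∈ E) {r : ℕ} (hr : r.Prime) (hr2 : r ≠ 2) {χ : Gal(E/K)}
    (hχr : zeta r ∈ fixedLift χ)
    (hχ : ∀ n : ℕ, n ∣ mK K → n.Coprime r → zeta n ∈ fixedLift χ) :
    zeta (mK K) ∈ fixedLift χ := by
  have hm := mK_spec hK
  obtain ⟨k, l, hrl, hl⟩ := Nat.exists_eq_pow_mul_and_not_dvd hm.1.ne' r hr.ne_one
  have hlr : l.Coprime r := ((Nat.Prime.coprime_iff_not_dvd hr).2 hrl).symm
  have hl0 : l ≠ 0 := by rintro rfl; simp at hrl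
  have hχl := hχ l (hl ▸ dvd_mul_left _ _) hlr
  suffices h : zeta (r ^ k) ∈ fixedLift χ by
    have := zeta_mul_mem _ (pow_ne_zero k hr.ne_zero) hl0 (hlr.symm.pow_left k) h hχl
    rwa [← hl] at this
  have hrk : r ^ k ≠ 0 := pow_ne_zero k hr.ne_zero
  have hzE : zeta (r ^ k) ∈ E := zeta_mem_of_dvd _ hm.1.ne' (hl ▸ dvd_mul_right _ _) hE
  rcases k with - | k
  · simp [zeta]
  set z : E := ⟨zeta (r ^ (k + 1)), hzE⟩ with hz
  have hzp : IsPrimitiveRoot z (r ^ (k + 1)) :=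
    IsPrimitiveRoot.coe_submonoidClass_iff.1 (isPrimitiveRoot_zeta hrk)
  obtain ⟨u, hu⟩ := exists_pow_of_isPrimitiveRoot χ hrk hzp
  have hfix : ∀ (n i : ℕ), (z ^ i : E) ^ u ^ n = z ^ i ↔
      ((r ^ (k + 1) : ℕ) : ℤ) ∣ i * ((u : ℤ) ^ n - 1) := by
    intro n i
    rw [← hzp.zpow_eq_one_iff_dvd, mul_sub, mul_one, zpow_sub₀ (hzp.ne_zero hrk),
      div_eq_one_iff_eq (zpow_ne_zero _ (hzp.ne_zero hrk)), ← pow_mul, ← zpow_natCast,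
      ← zpow_natCast z i]
    push_cast
    rfl
  have hfix' : ∀ (n i : ℕ), (χ ^ n) (z ^ i) = z ^ i ↔
      ((r ^ (k + 1) : ℕ) : ℤ) ∣ i * ((u : ℤ) ^ n - 1) := by
    intro n i
    rw [← hfix, map_pow, pow_apply_of_apply_eq_pow hu, ← pow_mul, ← pow_mul, mul_comm]
  -- As `χ` fixes `ζ_r`, the exponent `u` is congruent to `1` modulo `r`.
  have hru : (r : ℤ) ∣ u - 1 := by
    have h1 : χ (z ^ r ^ k) = z ^ r ^ k := by
      rw [← coe_mem_fixedLift]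
      have h2 : IsPrimitiveRoot (zeta (r ^ (k + 1)) ^ r ^ k) r :=
        (isPrimitiveRoot_zeta hrk).pow (Nat.pos_of_ne_zero hrk) (pow_succ r k)
      have := NeZero.mk hr.ne_zero
      obtain ⟨i, -, hi⟩ := (isPrimitiveRoot_zeta hr.ne_zero).eq_pow_of_pow_eq_one h2.pow_eq_one
      change zeta (r ^ (k + 1)) ^ r ^ k ∈ fixedLift χ
      rw [← hi]
      exact pow_mem hχr i
    rw [← pow_one χ, hfix', pow_one, pow_succ] at h1
    push_cast at h1
    exact Int.dvd_of_mul_dvd_mul_left (pow_ne_zero k (by exact_mod_cast hr.ne_zero)) h1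
  by_contra hcon
  have hcon' : ¬ ((r ^ (k + 1) : ℕ) : ℤ) ∣ (u : ℤ) - 1 := by
    have h1 := hfix' 1 1
    rw [pow_one, pow_one, ← coe_mem_fixedLift, pow_one, Nat.cast_one, one_mul] at h1
    rwa [← h1]
  have hu1 : (u : ℤ) - 1 ≠ 0 := by rintro h; simp [h] at hcon'
  have hr' : ¬ (r : ℤ) ∣ u := by
    intro h
    have := dvd_sub h hru
    rw [sub_sub_cancel] at this
    exact hr.one_lt.ne' (by simpa using Int.natAbs_dvd_natAbs.2 this)
  -- The power `χ ^ r ^ i` with `i = k - v_r (u - 1)` has an exponent of valuation exactly `k`.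
  have hfin : FiniteMultiplicity (r : ℤ) (u - 1) :=
    Int.finiteMultiplicity_iff.2 ⟨by simpa using hr.ne_one, hu1⟩
  set c := multiplicity (r : ℤ) (u - 1) with hc
  have hck : c ≤ k := by
    by_contra hck
    apply hcon'
    push_cast
    exact pow_dvd_of_le_multiplicity (by omega)
  have hLTE := Int.emultiplicity_pow_sub_pow (p := r) hr (hr.odd_of_ne_two hr2) (x := u) (y := 1)
    hru hr' (r ^ (k - c))
  rw [hfin.emultiplicity_eq_multiplicity, ← hc, hr.emultiplicity_pow_self, one_pow] at hLTE
  have hLTE' : emultiplicity (r : ℤ) (u ^ r ^ (k - c) - 1) = k := by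
    rw [hLTE]
    exact_mod_cast (by omega : c + (k - c) = k)
  have hd := (emultiplicity_eq_coe.1 hLTE')
  rcases Nat.eq_zero_or_pos k with rfl | hk
  · exact hcon' (by simpa using hru)
  have h3 : zeta (r ^ k) ∈ fixedLift (χ ^ r ^ (k - c)) := by
    have h4 : (χ ^ r ^ (k - c)) (z ^ r) = z ^ r := by
      rw [hfix', pow_succ']
      push_cast
      exact mul_dvd_mul_left _ hd.1
    rw [← coe_mem_fixedLift] at h4
    refine zeta_mem_of_isPrimitiveRoot _ (pow_ne_zero k hr.ne_zero)
      ((isPrimitiveRoot_zeta hrk).pow (Nat.pos_of_ne_zero hrk) (pow_succ' r k)) h4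
  have h5 := zeta_mul_mem _ (pow_ne_zero k hr.ne_zero) hl0 (hlr.symm.pow_left k) h3
    (fixedLift_le_fixedLift_pow χ _ hχl)
  have h6 := zeta_mem_fixedLift_of_sq_dvd hK hr hr2 (l := r ^ k * l)
    (by rw [hl, pow_succ']; ring) (dvd_mul_of_dvd_left (dvd_pow_self r hk.ne') l) h5
  have h7 : (z : ℂ) ∈ fixedLift (χ ^ r ^ (k - c)) :=
    zeta_mem_of_dvd _ hm.1.ne' (hl ▸ dvd_mul_right _ _) h6
  rw [coe_mem_fixedLift, ← pow_one z, hfix', Nat.cast_one, one_mul] at h7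
  exact hd.2 (by exact_mod_cast h7)

end

/-! ### Ramification in `K(ζ_r)/K` -/

section

theorem isCyclotomicExtension_adjoinZeta (K : IntermediateField ℚ ℂ) {n : ℕ} (hn : n ≠ 0) :
    IsCyclotomicExtension {n} K (adjoinZeta K {n}) := by
  have := isCyclotomicExtension_adjoin_zeta K hn
  unfold adjoinZeta
  rwa [Set.image_singleton]

variable {K : IntermediateField ℚ ℂ}

theorem zeta_mem_adjoinZeta {S : Set ℕ} {n : ℕ} (hn : n ∈ S) : zeta n ∈ adjoinZeta K S :=
  IntermediateField.subset_adjoin _ _ (Set.mem_image_of_mem _ hn)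

theorem eK_dvd (hK : IsAbelianNumberField K) {r : ℕ} (hr : r.Prime) (P : Ideal (𝓞 K))
    [P.IsPrime] : eK K r P ∣ r - 1 := by
  have := numberField_of_isAbelianNumberField hK
  have := isCyclotomicExtension_adjoinZeta K hr.ne_zero
  have := NeZero.mk hr.ne_zero
  have := IsCyclotomicExtension.finiteDimensional {r} K (adjoinZeta K {r})
  have : NumberField (adjoinZeta K {r}) := NumberField.of_module_finite K _
  have := IsCyclotomicExtension.isGalois {r} K (adjoinZeta K {r})
  refine (ramificationIdxIn_dvd_card_gal P).trans ?_
  have h1 := IsCyclotomicExtension.zeta_spec r K (adjoinZeta K {r})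
  have := Subgroup.card_dvd_of_injective _ (h1.autToPow_injective K)
  rwa [Nat.card_eq_fintype_card (α := (ZMod r)ˣ), ZMod.card_units_eq_totient,
    Nat.totient_prime hr] at this

/-- The ramification index `e` of `K(ζ_r)/K` at `r` kills the inertia group of `K(S)/K` at `r`, when
`S` consists of the conductor of `K` and of numbers that are prime to `r` or equal to `r`. -/
theorem pow_eK_eq_one (hK : IsAbelianNumberField K) {r : ℕ} (hr : r.Prime) (hr2 : r ≠ 2)
    {S : Set ℕ} (hmS : mK K ∈ S) (hS : ∀ n ∈ S, n = mK K ∨ n = r ∨ n.Coprime r)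
    {R : Ideal (𝓞 (adjoinZeta K S))} (hR : R.IsPrime) (hrR : (r : 𝓞 (adjoinZeta K S)) ∈ R)
    {θ : Gal(adjoinZeta K S/K)} (hθ : θ ∈ R.inertia Gal(adjoinZeta K S/K)) :
    θ ^ eK K r (R.under (𝓞 K)) = 1 := by
  have := numberField_of_isAbelianNumberField hK
  have hm := mK_spec hK
  set χ := θ ^ eK K r (R.under (𝓞 K)) with hχ
  have hcop : ∀ n : ℕ, n ≠ 0 → n.Coprime r → zeta n ∈ adjoinZeta K S → zeta n ∈ fixedLift χ := by
    intro n hn hnr h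
    refine fixedLift_le_fixedLift_pow θ _ ?_
    have h1 : (⟨zeta n, h⟩ : adjoinZeta K S) ^ n = 1 :=
      Subtype.ext (isPrimitiveRoot_zeta hn).pow_eq_one
    exact (coe_mem_fixedLift (χ := θ)).2 (apply_eq_self_of_mem_inertia hR hrR hθ hnr h1)
  have hne : ∀ n : ℕ, n.Coprime r → n ≠ 0 := by
    rintro n h rfl
    exact hr.ne_one (Nat.coprime_zero_left r |>.1 h)
  have hmE : zeta (mK K) ∈ adjoinZeta K S := zeta_mem_adjoinZeta hmS
  -- The restriction of `χ` to `K(ζ_r)` is trivial.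
  have hzr : zeta r ∈ adjoinZeta K S → zeta r ∈ fixedLift χ := by
    intro h
    have hle : adjoinZeta K {r} ≤ adjoinZeta K S := by
      refine IntermediateField.adjoin_le_iff.2 ?_
      rintro _ ⟨n, hn, rfl⟩
      rwa [Set.mem_singleton_iff.1 hn]
    let := (IntermediateField.inclusion hle).toRingHom.toAlgebra
    have : IsScalarTower K (adjoinZeta K {r}) (adjoinZeta K S) :=
      IsScalarTower.of_algebraMap_eq fun x => rfl
    have := isCyclotomicExtension_adjoinZeta K hr.ne_zero
    have := NeZero.mk hr.ne_zero
    have := IsCyclotomicExtension.finiteDimensional {r} K (adjoinZeta K {r})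
    have : NumberField (adjoinZeta K {r}) := NumberField.of_module_finite K _
    have := IsCyclotomicExtension.isGalois {r} K (adjoinZeta K {r})
    have hk : R.under (𝓞 K) ≠ ⊥ := by
      intro hbot
      have h2 : (r : 𝓞 K) ∈ R.under (𝓞 K) := by
        change algebraMap (𝓞 K) (𝓞 (adjoinZeta K S)) r ∈ R
        rwa [map_natCast]
      rw [hbot, Ideal.mem_bot] at h2
      exact hr.ne_zero (by exact_mod_cast h2)
    have h3 := restrictNormal_pow_ramificationIdxIn (L := adjoinZeta K {r}) hR hk hθ
    have h4 := AlgEquiv.restrictNormal_commutes χ (adjoinZeta K {r})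
      ⟨zeta r, zeta_mem_adjoinZeta rfl⟩
    have h5 : χ.restrictNormal (adjoinZeta K {r}) = 1 := by
      rw [← h3]
      exact map_pow (AlgEquiv.restrictNormalHom (adjoinZeta K {r})) θ _
    rw [h5] at h4
    exact (coe_mem_fixedLift (x := ⟨zeta r, h⟩)).2 h4.symm
  have hmfix : zeta (mK K) ∈ fixedLift χ := by
    by_cases hrm : r ∣ mK K
    · refine zeta_mem_fixedLift hK hmE hr hr2 (hzr (zeta_mem_of_dvd _ hm.1.ne' hrm hmE)) ?_
      intro n hn hnr
      exact hcop n (hne n hnr) hnr (zeta_mem_of_dvd _ hm.1.ne' hn hmE)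
    · exact hcop _ hm.1.ne' ((Nat.Prime.coprime_iff_not_dvd hr).2 hrm).symm hmE
  refine eq_one_of_le_fixedLift (IntermediateField.adjoin_le_iff.2 ?_)
  rintro _ ⟨n, hn, rfl⟩
  rcases hS n hn with rfl | rfl | h
  · exact hmfix
  · exact hzr (zeta_mem_adjoinZeta hn)
  · exact hcop n (hne n h) h (zeta_mem_adjoinZeta hn)

/-! ### Products of basis elements of a crossed product -/

namespace CrossedProduct

section

variable {k E : Type*} [Field k] [Field E] [Algebra k E] (α : FactorSet k E)

/-- The embedding of `Eˣ` into the unit group of `(E/k, α)`. -/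
noncomputable def scalar : Eˣ →* (CrossedProduct α)ˣ :=
  Units.map
    { toFun := fun a => single α 1 a
      map_one' := rfl
      map_mul' := fun a b => by
        rw [single_mul_single, α.map_one_left]
        simp }

theorem scalar_val (a : Eˣ) : (scalar α a : CrossedProduct α) = single α 1 a := rfl

theorem scalar_injective : Function.Injective (scalar α) := by
  intro a b h
  have h1 : single α 1 (a : E) = single α 1 b := congrArg Units.val h
  exact Units.ext (Finsupp.single_injective _ h1)

theorem scalar_neg_one : scalar α (-1) = -1 := by
  ext
  rw [scalar_val, Units.val_neg, Units.val_neg, Units.val_one, Units.val_one, one_def]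
  exact Finsupp.single_neg _ _

theorem u_one : u α 1 = 1 := Units.ext rfl

theorem u_mul_scalar (g : Gal(E/k)) (a : Eˣ) :
    u α g * scalar α a * (u α g)⁻¹ = scalar α (Units.map (g : E →* E) a) := by
  rw [mul_inv_eq_iff_eq_mul]
  ext
  change single α g 1 * single α 1 (a : E) = single α 1 (g a) * single α g 1
  rw [single_mul_single, single_mul_single, α.map_one_left, α.map_one_right]
  simp

theorem u_mul_u (g h : Gal(E/k)) : u α g * u α h = scalar α (α.toFun (g, h)) * u α (g * h) := by
  ext
  change single α g 1 * single α h 1 = single α 1 (α.toFun (g, h) : E) * single α (g * h) 1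
  rw [single_mul_single, single_mul_single, α.map_one_left]
  simp

variable {α} {w : Eˣ} (hα : ∀ x, α.toFun x ∈ Subgroup.zpowers w)

theorem u_conj_of_apply_eq {g : Gal(E/k)} {t : ℤ} (h : g w = (w : E) ^ t) :
    u α g * scalar α w * (u α g)⁻¹ = scalar α w ^ t := by
  rw [u_mul_scalar, ← map_zpow]
  congr 1
  ext
  simpa using h

include hα

theorem u_mul_u_eq_zpow (g h : Gal(E/k)) :
    ∃ i : ℤ, u α g * u α h = scalar α w ^ i * u α (g * h) := by
  obtain ⟨i, hi⟩ := hα (g, h)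
  exact ⟨i, by rw [u_mul_u, ← hi, map_zpow]⟩

/-- Basis elements of commuting automorphisms commute up to a power of `w`. -/
theorem exists_u_conj_u {g h : Gal(E/k)} (hgh : g * h = h * g) :
    ∃ i : ℤ, u α g * u α h * (u α g)⁻¹ = scalar α w ^ i * u α h := by
  obtain ⟨i, hi⟩ := u_mul_u_eq_zpow hα g h
  obtain ⟨j, hj⟩ := u_mul_u_eq_zpow hα h g
  refine ⟨i - j, ?_⟩
  rw [mul_inv_eq_iff_eq_mul, hi, mul_assoc, hj, hgh, ← mul_assoc, ← zpow_add, sub_add_cancel]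

/-- `x` is a multiple of the basis element `u_g` by a power of `w`. -/
def IsMultiple (α : FactorSet k E) (w : Eˣ) (g : Gal(E/k)) (x : (CrossedProduct α)ˣ) : Prop :=
  ∃ i : ℤ, x = scalar α w ^ i * u α g

omit hα in
theorem isMultiple_u (g : Gal(E/k)) : IsMultiple α w g (u α g) := ⟨0, by simp⟩

omit hα in
theorem isMultiple_one : IsMultiple α w 1 1 := ⟨0, by simp [u_one]⟩

variable {n : ℕ} (hn : n ≠ 0) (hw : IsPrimitiveRoot (w : E) n)
include hn hw

theorem IsMultiple.mul {g h : Gal(E/k)} {x y : (CrossedProduct α)ˣ} (hx : IsMultiple α w g x)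
    (hy : IsMultiple α w h y) : IsMultiple α w (g * h) (x * y) := by
  obtain ⟨i, rfl⟩ := hx
  obtain ⟨j, rfl⟩ := hy
  obtain ⟨l, hl⟩ := u_mul_u_eq_zpow hα g h
  obtain ⟨t, ht⟩ := exists_pow_of_isPrimitiveRoot g hn hw
  have h1 := conj_zpow_of_conj (u_conj_of_apply_eq (α := α) (t := t) (by simpa using ht)) j
  rw [mul_inv_eq_iff_eq_mul] at h1
  refine ⟨i + t * j + l, ?_⟩
  rw [show scalar α w ^ i * u α g * (scalar α w ^ j * u α h) =
    scalar α w ^ i * (u α g * scalar α w ^ j) * u α h by group, h1,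
    show ∀ v, scalar α w ^ i * (v * u α g) * u α h = scalar α w ^ i * v * (u α g * u α h) by
      intro v; group, hl, ← mul_assoc, ← zpow_add, ← zpow_add]

theorem IsMultiple.pow {g : Gal(E/k)} {x : (CrossedProduct α)ˣ} (hx : IsMultiple α w g x)
    (j : ℕ) : IsMultiple α w (g ^ j) (x ^ j) := by
  induction j with
  | zero => simpa using isMultiple_one
  | succ j ih => rw [pow_succ, pow_succ]; exact ih.mul hα hn hw hx

theorem isMultiple_listProd {ι : Type*} (l : List ι) (g : ι → Gal(E/k))
    (x : ι → (CrossedProduct α)ˣ) (h : ∀ i, IsMultiple α w (g i) (x i)) :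
    IsMultiple α w (l.map g).prod (l.map x).prod := by
  induction l with
  | nil => exact isMultiple_one
  | cons i l ih => exact (h i).mul hα hn hw ih

theorem exists_u_pow_eq {g : Gal(E/k)} {e : ℕ} (h : g ^ e = 1) :
    ∃ γ : ℤ, u α g ^ e = scalar α w ^ γ := by
  obtain ⟨γ, hγ⟩ := (isMultiple_u (α := α) (w := w) g).pow hα hn hw e
  exact ⟨γ, by rw [hγ, h, u_one, mul_one]⟩

end

end CrossedProduct

end

/-! ### The action of the Galois group on `ζ` -/

section

variable {K : IntermediateField ℚ ℂ} {p q : ℕ}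

theorem isPrimitiveRoot_zetaW (hp : p.Prime) :
    IsPrimitiveRoot (zetaW K p q) (p ^ (aK K p + bK K p)) :=
  IsPrimitiveRoot.coe_submonoidClass_iff.1 (isPrimitiveRoot_zeta (pow_ne_zero _ hp.ne_zero))

theorem mem_galOver {E : IntermediateField K ℂ} {S : Set E} {g : Gal(E/K)} :
    g ∈ galOver E S ↔ ∀ x ∈ S, g x = x := by
  constructor
  · intro h x hx
    exact h ⟨x, IntermediateField.subset_adjoin _ _ hx⟩
  · intro h
    have h1 : IntermediateField.adjoin K S ≤
        IntermediateField.fixedField (Subgroup.zpowers g) := by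
      refine IntermediateField.adjoin_le_iff.2 fun x hx => ?_
      rintro ⟨f, hf⟩
      have : Subgroup.zpowers g ≤ MulAction.stabilizer Gal(E/K) x := by
        rw [Subgroup.zpowers_le]; exact h x hx
      exact this hf
    rintro ⟨x, hx⟩
    exact h1 hx ⟨g, Subgroup.mem_zpowers g⟩

theorem mem_G {g : Gq K p q} : g ∈ G K p q ↔ g (zetaQ K p q) = zetaQ K p q := by
  simp [G, mem_galOver]

theorem mem_C {g : Gq K p q} : g ∈ C K p q ↔
    g (zetaQ K p q) = zetaQ K p q ∧ g (zetaW K p q) = zetaW K p q := by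
  simp [C, mem_galOver]

theorem mem_D {g : Gq K p q} : g ∈ D K p q ↔
    g (zetaQ K p q) = zetaQ K p q ∧
      g (zetaW K p q + (zetaW K p q)⁻¹) = zetaW K p q + (zetaW K p q)⁻¹ := by
  simp [D, mem_galOver]

theorem Gq_comm (f g : Gq K p q) : f * g = g * f :=
  (isMulCommutative_gal K {mK K, p ^ (aK K p + bK K p), q}).is_comm.comm f g

/-- `g` raises `ζ` to the power `t`. -/
def ActsBy (g : Gq K p q) (t : ℤ) : Prop := g (zetaW K p q) = zetaW K p q ^ t

namespace ActsBy

variable {f g : Gq K p q} {t t' : ℤ}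

theorem mul (h : ActsBy f t) (h' : ActsBy g t') : ActsBy (f * g) (t * t') := by
  unfold ActsBy at *
  rw [AlgEquiv.mul_apply, h', map_zpow₀, h, ← zpow_mul]

theorem one : ActsBy (1 : Gq K p q) 1 := by
  unfold ActsBy
  rw [AlgEquiv.one_apply, zpow_one]

theorem pow (h : ActsBy g t) (n : ℕ) : ActsBy (g ^ n) (t ^ n) := by
  induction n with
  | zero => simpa using one
  | succ n ih => rw [pow_succ, pow_succ]; exact ih.mul h

theorem dvd_sub (hp : p.Prime) (h : ActsBy g t) (h' : ActsBy g t') :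
    (p : ℤ) ^ (aK K p + bK K p) ∣ t - t' := by
  have hz := isPrimitiveRoot_zetaW (K := K) (q := q) hp
  have h0 := hz.ne_zero (pow_ne_zero _ hp.ne_zero)
  have h1 : zetaW K p q ^ t = zetaW K p q ^ t' := h.symm.trans h'
  have := (hz.zpow_eq_one_iff_dvd (t - t')).1 (by
    rw [zpow_sub₀ h0, h1, div_self (zpow_ne_zero _ h0)])
  exact_mod_cast this

theorem of_dvd (hp : p.Prime) (h : ActsBy g t)
    (hd : (p : ℤ) ^ (aK K p + bK K p) ∣ t - t') : ActsBy g t' := by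
  have hz := isPrimitiveRoot_zetaW (K := K) (q := q) hp
  have h0 := hz.ne_zero (pow_ne_zero _ hp.ne_zero)
  have h1 := (hz.zpow_eq_one_iff_dvd (t - t')).2 (by exact_mod_cast hd)
  rw [zpow_sub₀ h0, div_eq_one_iff_eq (zpow_ne_zero _ h0)] at h1
  exact Eq.trans h h1

end ActsBy

theorem actsBy_one_of_mem_C {g : Gq K p q} (h : g ∈ C K p q) : ActsBy g 1 := by
  unfold ActsBy
  rw [zpow_one]
  exact (mem_C.1 h).2

theorem mem_C_of_actsBy {g : Gq K p q} (h : g ∈ G K p q) (h' : ActsBy g 1) : g ∈ C K p q := by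
  unfold ActsBy at h'
  rw [zpow_one] at h'
  exact mem_C.2 ⟨mem_G.1 h, h'⟩

theorem D_le_G : D K p q ≤ G K p q := fun _ h => mem_G.2 (mem_D.1 h).1

theorem C_le_D : C K p q ≤ D K p q := fun g h => by
  rw [mem_C] at h
  rw [mem_D]
  exact ⟨h.1, by rw [map_add, map_inv₀, h.2]⟩

theorem actsBy_of_mem_D (hp : p.Prime) {g : Gq K p q} (h : g ∈ D K p q) :
    ActsBy g 1 ∨ ActsBy g (-1) := by
  have h0 := (isPrimitiveRoot_zetaW (K := K) (q := q) hp).ne_zero (pow_ne_zero _ hp.ne_zero)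
  have h1 := (mem_D.1 h).2
  rw [map_add, map_inv₀] at h1
  unfold ActsBy
  rw [zpow_one, zpow_neg_one]
  set z := zetaW K p q
  have hg : g z ≠ 0 := by simpa using h0
  have h2 : (g z - z) * (g z - z⁻¹) = 0 := by
    field_simp at h1 ⊢
    linear_combination h1
  rcases mul_eq_zero.1 h2 with h3 | h3
  · exact Or.inl (sub_eq_zero.1 h3)
  · exact Or.inr (sub_eq_zero.1 h3)

/-- If an element of `G_q` inverts `ζ`, then it both fixes and inverts `ζ_{p^a} ∈ K`, so
`p^a = 2`. -/
theorem eq_two_of_actsBy_neg_one (hK : IsAbelianNumberField K) (hp : p.Prime) (hpK : zeta p ∈ K)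
    {g : Gq K p q} (h : ActsBy g (-1)) : p = 2 ∧ aK K p = 1 := by
  have ha := one_le_aK hK hp hpK
  have hpa : p ^ aK K p ≠ 0 := pow_ne_zero _ hp.ne_zero
  have hy : IsPrimitiveRoot (zetaW K p q ^ p ^ bK K p) (p ^ aK K p) :=
    (isPrimitiveRoot_zetaW hp).pow (pow_pos hp.pos _) (by rw [pow_add, mul_comm])
  have := NeZero.mk hpa
  have hyC : ((zetaW K p q ^ p ^ bK K p : Fq K p q) : ℂ) ^ p ^ aK K p = 1 := by
    exact_mod_cast congrArg Subtype.val hy.pow_eq_one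
  obtain ⟨i, -, hi⟩ := (isPrimitiveRoot_zeta hpa).eq_pow_of_pow_eq_one hyC
  have hg : g (zetaW K p q ^ p ^ bK K p) = zetaW K p q ^ p ^ bK K p := by
    have h1 : zetaW K p q ^ p ^ bK K p =
        algebraMap K (Fq K p q) (⟨zeta (p ^ aK K p), zeta_pow_aK_mem hK hp⟩ ^ i) :=
      Subtype.ext hi.symm
    rw [h1, AlgEquiv.commutes]
  unfold ActsBy at h
  rw [map_pow, h, zpow_neg_one, inv_pow] at hg
  have h0 := hy.ne_zero hpa
  have h2 : (zetaW K p q ^ p ^ bK K p) ^ 2 = 1 := by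
    rw [pow_two]
    nth_rewrite 1 [← hg]
    exact inv_mul_cancel₀ h0
  have h3 := hy.dvd_of_pow_eq_one _ h2
  have h4 : p = 2 :=
    (Nat.prime_dvd_prime_iff_eq hp Nat.prime_two).1 ((dvd_pow_self p (by omega)).trans h3)
  subst h4
  refine ⟨rfl, ?_⟩
  have := (Nat.pow_dvd_pow_iff_le_right (x := 2) (k := aK K 2) (l := 1) one_lt_two).1
    (by simpa using h3)
  omega

theorem zeta_lcm_mem (L : IntermediateField K ℂ) {x y : ℕ} (hx : x ≠ 0) (hy : y ≠ 0)
    (h : zeta x ∈ L) (h' : zeta y ∈ L) : zeta (x.lcm y) ∈ L :=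
  zeta_mem_of_isPrimitiveRoot L (Nat.lcm_ne_zero hx hy)
    ((isPrimitiveRoot_zeta hx).pow_mul_pow_lcm (isPrimitiveRoot_zeta hy) hx hy)
    (mul_mem (pow_mem h _) (pow_mem h' _))

theorem exists_isCyclotomicExtension_Fq (hK : IsAbelianNumberField K) (hp : p.Prime)
    (hq : q.Prime) : ∃ N : ℕ, N ≠ 0 ∧ IsCyclotomicExtension {N} K (Fq K p q) := by
  have hm := (mK_spec hK).1.ne'
  have hpb := pow_ne_zero (aK K p + bK K p) hp.ne_zero
  set N := (mK K).lcm ((p ^ (aK K p + bK K p)).lcm q)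
  have hN : N ≠ 0 := Nat.lcm_ne_zero hm (Nat.lcm_ne_zero hpb hq.ne_zero)
  refine ⟨N, hN, ?_⟩
  have heq : Fq K p q = adjoinZeta K {N} := by
    apply le_antisymm
    · refine IntermediateField.adjoin_le_iff.2 ?_
      have hN' : zeta N ∈ adjoinZeta K {N} := zeta_mem_adjoinZeta rfl
      rintro _ ⟨n, hn, rfl⟩
      refine zeta_mem_of_dvd _ hN ?_ hN'
      rcases hn with rfl | rfl | rfl
      · exact Nat.dvd_lcm_left _ _
      · exact (Nat.dvd_lcm_left _ _).trans (Nat.dvd_lcm_right _ _)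
      · exact (Nat.dvd_lcm_right _ _).trans (Nat.dvd_lcm_right _ _)
    · refine IntermediateField.adjoin_le_iff.2 ?_
      rintro _ ⟨n, rfl, rfl⟩
      exact zeta_lcm_mem _ hm (Nat.lcm_ne_zero hpb hq.ne_zero) (zeta_mem_adjoinZeta (by simp))
        (zeta_lcm_mem _ hpb hq.ne_zero (zeta_mem_adjoinZeta (by simp))
          (zeta_mem_adjoinZeta (by simp)))
  rw [heq]
  exact isCyclotomicExtension_adjoinZeta K hN

theorem finite_Gq (hK : IsAbelianNumberField K) (hp : p.Prime) (hq : q.Prime) :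
    Finite (Gq K p q) := by
  obtain ⟨N, hN, h⟩ := exists_isCyclotomicExtension_Fq hK hp hq
  have := NeZero.mk hN
  have := IsCyclotomicExtension.finiteDimensional {N} K (Fq K p q)
  infer_instance

/-- `ζ` does not lie in `K(ζ_q)`: otherwise `p ^ (a + b)` would divide `2 m`. -/
theorem C_ne_G (hK : IsAbelianNumberField K) (hp : p.Prime) (hpK : zeta p ∈ K) (hq : q.Prime)
    (hq2 : q ≠ 2) (hqm : ¬ q ∣ mK K) : C K p q ≠ G K p q := by
  intro hCG
  have := Fact.mk hp
  have hm := mK_spec hK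
  obtain ⟨N, hN, h⟩ := exists_isCyclotomicExtension_Fq hK hp hq
  have := NeZero.mk hN
  have := IsCyclotomicExtension.finiteDimensional {N} K (Fq K p q)
  have := IsCyclotomicExtension.isGalois {N} K (Fq K p q)
  have hmem : zetaW K p q ∈ IntermediateField.adjoin K {zetaQ K p q} := by
    rw [← IsGalois.fixedField_fixingSubgroup (IntermediateField.adjoin K {zetaQ K p q})]
    rintro ⟨g, hg⟩
    have hg' : g ∈ G K p q := hg
    rw [← hCG] at hg'
    exact (mem_C.1 hg').2
  rw [← IntermediateField.mem_lift, IntermediateField.lift_adjoin_simple] at hmem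
  have hmq : mK K * q ≠ 0 := mul_ne_zero hm.1.ne' hq.ne_zero
  have hzmq := zeta_mem_cyclotomic (mK K * q)
  have hKmq : K ≤ cyclotomic (mK K * q) :=
    hm.2.2.trans (cyclotomic_le (zeta_mem_of_dvd _ hmq (dvd_mul_right _ _) hzmq))
  have hle : IntermediateField.adjoin K {(zetaQ K p q : ℂ)} ≤
      IntermediateField.extendScalars hKmq :=
    IntermediateField.adjoin_simple_le_iff.2 (zeta_mem_of_dvd _ hmq (dvd_mul_left _ _) hzmq)
  have hz : zeta (p ^ (aK K p + bK K p)) ∈ cyclotomic (mK K * q) := hle hmem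
  have hd := dvd_two_mul_of_zeta_mem hmq (pow_ne_zero _ hp.ne_zero) hz
  have hpq : p ≠ q := by
    rintro rfl
    exact hqm (dvd_mK hK hp hpK)
  rw [← mul_assoc] at hd
  have hd' := Nat.Coprime.dvd_of_dvd_mul_right
    (((Nat.coprime_primes hp hq).2 hpq).pow_left _) hd
  have ha := one_le_aK hK hp hpK
  rw [padicValNat_dvd_iff_le (mul_ne_zero two_ne_zero hm.1.ne'),
    padicValNat.mul two_ne_zero hm.1.ne'] at hd'
  have hs : padicValNat p (mK K) = sK K p := rfl
  have hsb := sK_le_bK (K := K) (p := p)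
  rcases eq_or_ne p 2 with rfl | hp2
  · rw [padicValNat.self one_lt_two] at hd'
    by_cases h4 : zeta 4 ∈ K
    · have := le_aK hK hp (x := 2) (by simpa using h4)
      omega
    · have := sK_lt_bK (p := 2) (by decide) h4
      omega
  · rw [padicValNat.eq_zero_of_not_dvd (n := 2)] at hd'
    · omega
    · intro h; exact hp2 ((Nat.prime_dvd_prime_iff_eq hp Nat.prime_two).1 h)

/-! ### The structure of `G/C` -/

section Adapted

variable {n : ℕ} {c : Fin (n + 1) → Gq K p q} {ρ σ : Gq K p q} {t : ℤ}

namespace IsAdapted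

variable (hc : IsAdapted c ρ σ t)
include hc

theorem B_le_C : B c ≤ C K p q := hc.C_eq ▸ le_sup_left

theorem rho_mem_D : ρ ∈ D K p q :=
  hc.D_eq ▸ (le_sup_right : Subgroup.zpowers ρ ≤ B c ⊔ _) (Subgroup.mem_zpowers ρ)

theorem sigma_mem_G : σ ∈ G K p q :=
  hc.G_eq ▸ (le_sup_right.trans le_sup_left :
    Subgroup.zpowers σ ≤ Subgroup.zpowers ρ ⊔ Subgroup.zpowers σ ⊔ C K p q)
    (Subgroup.mem_zpowers σ)

theorem actsBy_sigma : ActsBy σ t := hc.sigma_zeta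

theorem actsBy_c_zero : ActsBy (c 0) 1 := by
  have h : c 0 ∈ galOver (Fq K p q) {x | (x : ℂ) ∈ F K p} :=
    hc.c_zero ▸ Subgroup.mem_zpowers (c 0)
  unfold ActsBy
  rw [zpow_one]
  exact mem_galOver.1 h _ (zeta_mem_adjoinZeta (by simp))

theorem actsBy_c (i : Fin (n + 1)) : ActsBy (c i) 1 := by
  refine Fin.cases hc.actsBy_c_zero (fun i => ?_) i
  refine actsBy_one_of_mem_C (hc.B_le_C ?_)
  exact (le_iSup (fun i : Fin n => Subgroup.zpowers (c i.succ)) i) (Subgroup.mem_zpowers _)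

theorem rho_eq_one_of_mem_C (h : ρ ∈ C K p q) : ρ = 1 := by
  refine hc.rho_eq_one (le_antisymm C_le_D ?_)
  rw [← hc.D_eq]
  exact sup_le hc.B_le_C (Subgroup.zpowers_le.2 h)

theorem rho_eq_one_or (hp : p.Prime) : ρ = 1 ∨ ρ ∉ C K p q ∧ ActsBy ρ (-1) := by
  by_cases h : ρ ∈ C K p q
  · exact Or.inl (hc.rho_eq_one_of_mem_C h)
  · refine Or.inr ⟨h, (actsBy_of_mem_D hp hc.rho_mem_D).resolve_left fun h1 => h ?_⟩
    exact mem_C_of_actsBy (D_le_G hc.rho_mem_D) h1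

theorem sigma_eq_one_of_mem_C (h : σ ∈ C K p q) : σ = 1 := by
  refine hc.sigma_eq_one (le_antisymm D_le_G ?_)
  rw [← hc.G_eq]
  exact sup_le (sup_le (Subgroup.zpowers_le.2 hc.rho_mem_D)
    (Subgroup.zpowers_le.2 (C_le_D h))) C_le_D

theorem isCyclic_of_rho_eq_one (h : ρ = 1) : IsCyclic (GmodC K p q) := by
  refine ⟨⟨QuotientGroup.mk ⟨σ, hc.sigma_mem_G⟩, ?_⟩⟩
  rintro ⟨y, hy⟩
  have hy' := hy
  rw [← hc.G_eq, h, Subgroup.zpowers_one_eq_bot, bot_sup_eq,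
    Subgroup.mem_sup_of_normal_right] at hy'
  obtain ⟨_, ⟨k, rfl⟩, z, hz, rfl⟩ := hy'
  refine ⟨k, (QuotientGroup.eq (s := (C K p q).subgroupOf (G K p q))
    (a := (⟨σ, hc.sigma_mem_G⟩ : G K p q) ^ k)).2 ?_⟩
  rw [Subgroup.mem_subgroupOf]
  change (σ ^ k)⁻¹ * (σ ^ k * z) ∈ C K p q
  rwa [inv_mul_cancel_left]

/-- When `G/C` is cyclic, one of `ρ` and `σ` is trivial: `⟨ρC⟩` has order at most `2`, the order of
`σC` is even unless `σ = 1`, and a cyclic group has only one element of order `2`. -/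
theorem eq_one_or_eq_one_of_isCyclic (hK : IsAbelianNumberField K) (hp : p.Prime)
    (hpK : zeta p ∈ K) (hq : q.Prime) (hcyc : IsCyclic (GmodC K p q)) : ρ = 1 ∨ σ = 1 := by
  rcases hc.rho_eq_one_or hp with h | ⟨hρC, hρ⟩
  · exact Or.inl h
  right
  obtain ⟨rfl, -⟩ := eq_two_of_actsBy_neg_one hK hp hpK hρ
  have := finite_Gq hK hp hq
  apply hc.sigma_eq_one_of_mem_C
  by_contra hσC
  set N := orderModC σ with hN
  have hN0 : 0 < N := orderOf_pos _
  have hσN : σ ^ N ∈ C K 2 q := by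
    rw [← QuotientGroup.eq_one_iff, QuotientGroup.mk_pow]
    exact pow_orderOf_eq_one _
  rcases Nat.even_or_odd' N with ⟨l, hl | hl⟩
  · have hlC : σ ^ l ∉ C K 2 q := by
      rw [← QuotientGroup.eq_one_iff, QuotientGroup.mk_pow]
      exact pow_ne_one_of_lt_orderOf (by omega) (show l < N by omega)
    have hρG := D_le_G hc.rho_mem_D
    have hσG := pow_mem hc.sigma_mem_G l
    set x : GmodC K 2 q := QuotientGroup.mk ⟨ρ, hρG⟩ with hx
    set y : GmodC K 2 q := QuotientGroup.mk ⟨σ ^ l, hσG⟩ with hy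
    have hiff : ∀ g : G K 2 q, (QuotientGroup.mk g : GmodC K 2 q) = 1 ↔ (g : Gq K 2 q) ∈ C K 2 q :=
      fun g => by rw [QuotientGroup.eq_one_iff, Subgroup.mem_subgroupOf]
    have hx1 : x ≠ 1 := fun h => hρC ((hiff _).1 h)
    have hy1 : y ≠ 1 := fun h => hlC ((hiff _).1 h)
    have hx2 : x ^ 2 = 1 := by
      rw [hx, ← QuotientGroup.mk_pow, hiff]
      exact hc.C_eq ▸ (le_sup_right : Subgroup.zpowers (ρ ^ 2) ≤ B c ⊔ _)
        (Subgroup.mem_zpowers (ρ ^ 2))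
    have hy2 : y ^ 2 = 1 := by
      rw [hy, ← QuotientGroup.mk_pow, hiff]
      change (σ ^ l) ^ 2 ∈ _
      rwa [← pow_mul, mul_comm, ← hl]
    have hxy : x = y := by
      classical
      by_contra hxy
      have := Fintype.ofFinite (GmodC K 2 q)
      have h1 := IsCyclic.card_pow_eq_one_le (α := GmodC K 2 q) (n := 2) two_pos
      have h2 : ({1, x, y} : Finset (GmodC K 2 q)) ⊆ Finset.univ.filter fun a => a ^ 2 = 1 := by
        intro a ha
        simp only [Finset.mem_insert, Finset.mem_singleton] at ha
        rcases ha with rfl | rfl | rfl <;> simp [hx2, hy2]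
      have h3 := Finset.card_le_card h2
      rw [Finset.card_eq_three.2 ⟨1, x, y, hx1.symm, hy1.symm, hxy, rfl⟩] at h3
      omega
    rw [hx, hy, eq_comm, QuotientGroup.eq, Subgroup.mem_subgroupOf] at hxy
    have hxy' : (σ ^ l)⁻¹ * ρ ∈ C K 2 q := hxy
    have hρσ : ρ ∈ Subgroup.zpowers σ ⊔ C K 2 q := by
      rw [← mul_inv_cancel_left (σ ^ l) ρ]
      exact mul_mem (Subgroup.mem_sup_left (pow_mem (Subgroup.mem_zpowers σ) l))
        (Subgroup.mem_sup_right hxy')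
    exact hρC (hc.rho_inf_sigma ▸ ⟨Subgroup.mem_sup_left (Subgroup.mem_zpowers ρ), hρσ⟩)
  · apply hσC
    refine mem_C_of_actsBy hc.sigma_mem_G (hc.actsBy_sigma.of_dvd hp ?_)
    have h1 := (hc.actsBy_sigma.pow N).dvd_sub hp (actsBy_one_of_mem_C hσN)
    have ht : (2 : ℤ) ∣ t - 1 := by
      have hodd : ¬ (2 : ℤ) ∣ t := by
        intro h
        have h2 : (2 : ℤ) ∣ t ^ N := dvd_pow h hN0.ne'
        have h3 : (2 : ℤ) ∣ t ^ N - 1 := (dvd_pow_self (2 : ℤ)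
          (by have := one_le_aK hK hp hpK; omega)).trans h1
        omega
      omega
    have h4 := two_dvd_geom_sum_sub ht N
    rw [← geom_sum_mul] at h1
    refine IsCoprime.dvd_of_dvd_mul_left (IsCoprime.pow_left ?_) h1
    obtain ⟨y, hy⟩ := h4
    exact ⟨-(y + l), 1, by rw [hl] at hy; push_cast at hy; rw [hl]; linear_combination hy⟩

end IsAdapted

end Adapted

end

/-! ### The cyclotomic algebra at `r` -/

section

variable {K : IntermediateField ℚ ℂ} {p q : ℕ}

/-- The values of the cocycle lie in the group generated by a power `w` of `ζ`, of order `p ^ M`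
with `M ≤ b`. -/
theorem IsRestricted.exists_root (hK : IsAbelianNumberField K) (hp : p.Prime)
    {α : FactorSet K (Fq K p q)} (hα : IsRestricted α) :
    ∃ (M i : ℕ) (w : (Fq K p q)ˣ), M ≤ bK K p ∧ IsPrimitiveRoot (w : Fq K p q) (p ^ M) ∧
      (w : Fq K p q) = zetaW K p q ^ i ∧ ∀ x, α.toFun x ∈ Subgroup.zpowers w := by
  obtain ⟨M, hM, hMb⟩ : ∃ M, (if p ^ sK K p = 2 then 4 else p ^ sK K p) = p ^ M ∧ M ≤ bK K p := by
    split_ifs with h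
    · obtain ⟨rfl, h2⟩ := two_le_bK hK h
      exact ⟨2, rfl, h2⟩
    · exact ⟨_, rfl, sK_le_bK⟩
  have hpM : p ^ M ≠ 0 := pow_ne_zero _ hp.ne_zero
  have := NeZero.mk hpM
  have hw : IsPrimitiveRoot (zetaW K p q ^ p ^ (aK K p + bK K p - M)) (p ^ M) := by
    refine (isPrimitiveRoot_zetaW hp).pow (pow_pos hp.pos _) ?_
    rw [← pow_add]
    congr 1
    omega
  have hwu : IsPrimitiveRoot (hw.isUnit hpM).unit (p ^ M) :=
    IsPrimitiveRoot.coe_units_iff.1 hw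
  refine ⟨M, _, (hw.isUnit hpM).unit, hMb, hw, rfl, fun x => ?_⟩
  rw [hwu.zpowers_eq, ← hM]
  exact hα x

theorem ActsBy.apply_pow {g : Gq K p q} {t : ℤ} (h : ActsBy g t) (i : ℕ) :
    g (zetaW K p q ^ i) = (zetaW K p q ^ i) ^ t := by
  unfold ActsBy at h
  rw [map_pow, h, ← zpow_natCast, ← zpow_natCast, ← zpow_mul, ← zpow_mul, mul_comm]

theorem IsFrobenius.actsBy (hp : p.Prime) {r : ℕ} (hpr : p.Coprime r) {φ : Gq K p q}
    (hφ : IsFrobenius r φ) : ActsBy φ ((r ^ fK K r : ℕ) : ℤ) := by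
  unfold ActsBy
  rw [zpow_natCast]
  exact hφ.2 (p ^ (aK K p + bK K p)) _ (hpr.pow_left _) (zeta_mem_adjoinZeta (by simp))
    (isPrimitiveRoot_zetaW hp).pow_eq_one

/-- The inertia group at a prime over `r ≠ p` fixes `ζ`. -/
theorem actsBy_of_mem_inertia (hp : p.Prime) {r : ℕ} (hpr : p.Coprime r)
    {R : Ideal (𝓞 (Fq K p q))} (hR : R.IsPrime) (hrR : (r : 𝓞 (Fq K p q)) ∈ R) {θ : Gq K p q}
    (hθ : θ ∈ R.inertia (Gq K p q)) : ActsBy θ 1 := by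
  unfold ActsBy
  rw [zpow_one]
  exact apply_eq_self_of_mem_inertia hR hrR hθ (hpr.pow_left (aK K p + bK K p))
    (isPrimitiveRoot_zetaW hp).pow_eq_one

/-- The exponent `ν` makes `p ^ ν (r ^ f - 1)` divisible by the `p`-part of `p ^ a e`. This includes
the case `r ^ f = 1`, in which the valuation of `r ^ f - 1` has the junk value `0`. -/
theorem pow_dvd_pow_nu_mul (hp : p.Prime) (r : ℕ) (P : Ideal (𝓞 K)) :
    (p : ℤ) ^ (aK K p + padicValNat p (eK K r P)) ∣
      (p : ℤ) ^ nu K p r P * ((r ^ fK K r - 1 : ℕ) : ℤ) := by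
  have := Fact.mk hp
  have h : p ^ padicValNat p (r ^ fK K r - 1) ∣ r ^ fK K r - 1 := pow_padicValNat_dvd
  have h1 := mul_dvd_mul_left (p ^ nu K p r P) h
  rw [← pow_add] at h1
  exact_mod_cast (pow_dvd_pow p (by unfold nu; omega)).trans h1

end

end CyclotomicAlgebra

theorem mainTheorem5 (K : IntermediateField ℚ ℂ) (hK : IsAbelianNumberField K)
    (p r q : ℕ) (hp : p.Prime) (hr : r.Prime) (hr2 : r ≠ 2) (hq : q.Prime) (hq2 : q ≠ 2)
    (hpK : zeta p ∈ K) (hrp : r ≡ 1 [MOD p]) (hqm : ¬ q ∣ mK K)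
    (n : ℕ) (c : Fin (n + 1) → Gq K p q) (ρ σ : Gq K p q) (t : ℤ) (hc : IsAdapted c ρ σ t)
    -- the Frobenius automorphism and its exponents
    (φ η : Gq K p q) (j j' : ℕ) (hφ : IsFrobenius r φ) (hη : η ∈ B c)
    (hφη : φ = ρ ^ j' * σ ^ j * η) (hj' : j' < orderOf ρ) (hj : j < orderModC σ)
    -- a generator `θ` of the inertia group at a prime `R` over `r`
    (R : Ideal (𝓞 (Fq K p q))) (hR : R.IsPrime) (hrR : (r : 𝓞 (Fq K p q)) ∈ R)
    (θ : Gq K p q) (hθ : Subgroup.zpowers θ = R.inertia (Gq K p q))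
    (s : Fin (n + 1) → ℕ) (s' : ℕ) (hs : ∀ i, s i < orderOf (c i)) (hs' : s' ≤ orderOf (ρ ^ 2))
    (hθs : θ = (List.ofFn fun i => c i ^ s i).prod * ρ ^ (2 * s'))
    -- the cyclotomic algebra `(F(ζ_q)/K, α)`
    (α : FactorSet K (Fq K p q)) (hα : IsRestricted α) :
    (IsCyclic (GmodC K p q) →
      xi0 α ρ σ θ j j' r (R.under (𝓞 K)) ^ p ^ nu K p r (R.under (𝓞 K)) = 1) ∧
    (¬ IsCyclic (GmodC K p q) →
      (∀ i, mu α ρ σ (c i) t = 1 ∨ mu α ρ σ (c i) t = -1) ∧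
      xi0 α ρ σ θ j j' r (R.under (𝓞 K)) ^ p ^ nu K p r (R.under (𝓞 K)) =
        (List.ofFn fun i =>
          mu α ρ σ (c i) t ^ (2 ^ nu K p r (R.under (𝓞 K)) * (j + j') * s i)).prod) := by
  have := Fact.mk hp
  have ha := one_le_aK hK hp hpK
  have hb : 1 ≤ bK K p := (one_le_sK hK hp hpK).trans sK_le_bK
  -- The primes `p` and `r` are distinct, as `r ≡ 1` modulo `p`.
  have hpr : p.Coprime r := by
    have := hrp.gcd_eq
    rw [Nat.gcd_one_left] at this
    exact Nat.coprime_comm.1 this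
  have hθR : θ ∈ R.inertia (Gq K p q) := hθ ▸ Subgroup.mem_zpowers θ
  have hθ1 := actsBy_of_mem_inertia hp hpr hR hrR hθR
  set e := eK K r (R.under (𝓞 K)) with he
  have her : e ∣ r - 1 := eK_dvd hK hr _
  have he0 : e ≠ 0 := by
    intro h
    rw [h, zero_dvd_iff] at her
    have := hr.two_le
    omega
  have hθe : θ ^ e = 1 := by
    refine pow_eK_eq_one hK hr hr2 (by simp) ?_ hR hrR hθR
    rintro x (rfl | rfl | rfl)
    · exact Or.inl rfl
    · exact Or.inr (Or.inr (hpr.pow_left _))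
    · by_cases h : x = r
      · exact Or.inr (Or.inl h)
      · exact Or.inr (Or.inr ((Nat.coprime_primes hq hr).2 h))
  have hQ : ((r ^ fK K r - 1 : ℕ) : ℤ) = e * ((r ^ fK K r - 1) / e : ℕ) := by
    rw [← Nat.cast_mul, Nat.mul_div_cancel' (her.trans (by
      simpa using Nat.sub_dvd_pow_sub_pow r 1 (fK K r)))]
  have hν := pow_dvd_pow_nu_mul hp r (R.under (𝓞 K))
  obtain ⟨M, i₀, w, hMb, hw, hwz, hαw⟩ := hα.exists_root hK hp
  have hpM : p ^ M ≠ 0 := pow_ne_zero _ hp.ne_zero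
  set ω := CrossedProduct.scalar α w with hω
  have hord : orderOf ω = p ^ M := by
    rw [hω, orderOf_injective _ (CrossedProduct.scalar_injective α), ← orderOf_units,
      hw.eq_orderOf]
  have hconj : ∀ {g : Gq K p q} {x : ℤ}, ActsBy g x →
      CrossedProduct.u α g * ω * (CrossedProduct.u α g)⁻¹ = ω ^ x := fun h =>
    CrossedProduct.u_conj_of_apply_eq (by rw [hwz, h.apply_pow])
  have hcomm : ∀ {g : Gq K p q}, ActsBy g 1 → Commute (CrossedProduct.u α g) ω := fun h => by
    have := hconj h
    rwa [zpow_one, mul_inv_eq_iff_eq_mul] at this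
  obtain ⟨γ, hγ⟩ := CrossedProduct.exists_u_pow_eq hαw hpM hw hθe
  have hη1 : ActsBy η 1 := actsBy_one_of_mem_C (hc.B_le_C hη)
  have hfrob := hφ.actsBy hp hpr
  have hrf : ((r ^ fK K r - 1 : ℕ) : ℤ) = ((r ^ fK K r : ℕ) : ℤ) - 1 := by
    rw [Nat.cast_sub (Nat.one_le_pow _ _ hr.pos), Nat.cast_one]
  -- The congruence between `r ^ f` and the exponent by which `ρ ^ j' σ ^ j` acts on `ζ`.
  have hcong : ∀ x : ℤ, ActsBy (ρ ^ j' * σ ^ j) x →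
      (p : ℤ) ^ (aK K p + bK K p) ∣ ((r ^ fK K r - 1 : ℕ) : ℤ) - (x - 1) := by
    intro x hx
    have h1 := hx.mul hη1
    rw [← hφη] at h1
    have := hfrob.dvd_sub hp h1
    rwa [mul_one, ← sub_sub_sub_cancel_right _ _ 1, ← hrf] at this
  constructor
  · intro hcyc
    unfold xi0
    rcases hc.eq_one_or_eq_one_of_isCyclic hK hp hpK hq hcyc with hρ | hσ
    · obtain rfl : j' = 0 := by rw [hρ, orderOf_one] at hj'; omega
      have hGD : G K p q ≠ D K p q := by
        intro h
        refine C_ne_G hK hp hpK hq hq2 hqm (le_antisymm (C_le_D.trans D_le_G) ?_)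
        rw [h, ← hc.D_eq, hρ, Subgroup.zpowers_one_eq_bot, sup_bot_eq]
        exact hc.B_le_C
      have hta := hc.val_cyclic hcyc hGD
      have ht0 : t - 1 ≠ 0 := by
        intro h
        rw [h, padicValInt.zero] at hta
        omega
      obtain ⟨β, hβ⟩ := CrossedProduct.exists_u_conj_u hαw (Gq_comm σ θ)
      rw [pow_zero, one_mul]
      refine commutator_pow_mul_pow_eq_one hp hord (hconj hc.actsBy_sigma) (hcomm hθ1) hβ hγ he0
        ht0 hta hMb hQ (hcong _ ?_) hν
      rw [pow_zero, one_mul]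
      exact hc.actsBy_sigma.pow j
    · obtain rfl : j = 0 := by
        rw [hσ, orderModC, QuotientGroup.mk_one, orderOf_one] at hj
        omega
      rw [pow_zero, mul_one]
      rw [pow_zero, mul_one] at hcong
      rcases hc.rho_eq_one_or hp with hρ | ⟨-, hρ⟩
      · -- Both `ρ` and `σ` are trivial, so that `G = C`.
        exfalso
        refine C_ne_G hK hp hpK hq hq2 hqm ?_
        rw [← hc.G_eq, hρ, hσ, Subgroup.zpowers_one_eq_bot, bot_sup_eq, bot_sup_eq]
      · obtain ⟨rfl, ha1⟩ := eq_two_of_actsBy_neg_one hK hp hpK hρ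
        obtain ⟨β, hβ⟩ := CrossedProduct.exists_u_conj_u hαw (Gq_comm ρ θ)
        refine commutator_pow_mul_pow_eq_one hp hord (hconj hρ) (hcomm hθ1) hβ hγ he0
          (by norm_num) ?_ hMb hQ (hcong _ (hρ.pow j')) hν
        rw [ha1, show (-1 - 1 : ℤ) = -((2 : ℕ) : ℤ) by norm_num, padicValInt, Int.natAbs_neg,
          Int.natAbs_natCast, padicValNat.self one_lt_two]
  · intro hcyc
    have hρ : ActsBy ρ (-1) := ((hc.rho_eq_one_or hp).resolve_left fun h =>
      hcyc (hc.isCyclic_of_rho_eq_one h)).2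
    obtain ⟨rfl, ha1⟩ := eq_two_of_actsBy_neg_one hK hp hpK hρ
    have ht4 : 4 ∣ t - 1 := by
      have := (padicValInt_dvd_iff (p := 2) 2 (t - 1)).2 (Or.inr (hc.val_noncyclic hcyc))
      simpa using this
    -- For `d = (1 - t) / 2`, the elements `μ` are the invariants of the `u_{c_i}`.
    set d := (1 - t) / 2 with hd
    have htd : 1 - t = 2 * d := by omega
    have hR1 := hconj hρ
    have hS1 := hconj hc.actsBy_sigma
    obtain ⟨z, hz⟩ := CrossedProduct.exists_u_conj_u hαw (Gq_comm σ ρ)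
    have hexists : ∀ i, ∃ β β' : ℤ,
        ConjBy ω (CrossedProduct.u α ρ) (CrossedProduct.u α σ) (CrossedProduct.u α (c i)) β β' := by
      intro i
      obtain ⟨β, hβ⟩ := CrossedProduct.exists_u_conj_u hαw (Gq_comm ρ (c i))
      obtain ⟨β', hβ'⟩ := CrossedProduct.exists_u_conj_u hαw (Gq_comm σ (c i))
      exact ⟨β, β', hcomm (hc.actsBy_c i), hβ, hβ'⟩
    choose β β' hβ using hexists
    have hmu : ∀ i, mu α ρ σ (c i) t = ω ^ (d * β i - β' i) := fun i =>
      (hβ i).commutatorInvariant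
    constructor
    · intro i
      have h1 := (hβ i).orderOf_dvd hR1 hS1 hz
      have h2 : ω ^ (2 * (d * β i - β' i)) = 1 := by
        rw [← orderOf_dvd_iff_zpow_eq_one]
        have : 2 * (d * β i - β' i) = -(2 * β' i - (1 - t) * β i) := by
          linear_combination -β i * htd
        rw [this]
        exact dvd_neg.2 h1
      rw [hω, ← map_zpow, ← map_one (CrossedProduct.scalar α)] at h2
      have h3 := CrossedProduct.scalar_injective α h2
      rw [mul_comm, zpow_mul] at h3
      have h4 : w ^ (d * β i - β' i) = 1 ∨ w ^ (d * β i - β' i) = -1 := by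
        have h5 := congrArg Units.val h3
        rw [Units.val_one] at h5
        have h6 : ((w ^ (d * β i - β' i) : (Fq K 2 q)ˣ) : Fq K 2 q) ^ 2 = 1 := by
          exact_mod_cast h5
        rcases mul_self_eq_one_iff.1 ((pow_two _).symm.trans h6) with h | h
        · exact Or.inl (Units.ext h)
        · exact Or.inr (Units.ext h)
      rw [hmu, hω, ← map_zpow]
      rcases h4 with h | h
      · exact Or.inl (by rw [h, map_one])
      · exact Or.inr (by rw [h, CrossedProduct.scalar_neg_one])
    · -- The product of powers of the `u_{c_i}` and of `u_ρ ^ 2` that corresponds to `θ` differs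
      -- from `u_θ` by a power of `ω`, so the two have the same invariant.
      obtain ⟨A, A', hA, hAK⟩ := ConjBy.listProd (d := d) (List.finRange (n + 1))
        (fun i => CrossedProduct.u α (c i)) s β β' hβ
      have hprod := hA.mul ((ConjBy.sq hR1 hz).pow s')
      rw [mul_zero, add_zero, add_zero] at hprod
      obtain ⟨l, hl⟩ : CrossedProduct.IsMultiple α w θ
          (((List.finRange (n + 1)).map fun i => CrossedProduct.u α (c i) ^ s i).prod *
            (CrossedProduct.u α ρ ^ 2) ^ s') := by
        rw [hθs, List.ofFn_eq_map, pow_mul]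
        have h2 := fun g : Gq K 2 q => CrossedProduct.isMultiple_u (α := α) (w := w) g
        exact (CrossedProduct.isMultiple_listProd hαw hpM hw _ _ _ fun i =>
          (h2 (c i)).pow hαw hpM hw (s i)).mul hαw hpM hw
            (((h2 ρ).pow hαw hpM hw 2).pow hαw hpM hw s')
      have hθconj := (ConjBy.zpow_self hR1 hS1 (-l)).mul hprod
      rw [hl, ← hω, ← mul_assoc, ← zpow_add, neg_add_cancel, zpow_zero, one_mul] at hθconj
      have hfin := hθconj.commutator_pow_mul_pow_eq (j := j) (j' := j')
        (ν := nu K 2 r (R.under (𝓞 K))) hord hR1 hS1 hz hγ he0 htd ht4 hMb hb hQ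
        (ha1 ▸ hcong _ ((hρ.pow j').mul (hc.actsBy_sigma.pow j)))
        (by rw [nu, ha1, padicValInt.of_nat])
      unfold xi0
      rw [hfin, List.ofFn_eq_map]
      simp only [hmu]
      rw [← hAK]
      congr 2
      linear_combination -l * htd
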